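/- Let $(X,\mathsf d,\mathfrak m)$ be a metric measure space, i.e. $(X,\mathsf d)$ is a complete separable metric space and $\mathfrak m\ge 0$ is a Borel measure on $X$ that is finite on bounded sets and has $\operatorname{supp}\mathfrak m=X$. Assume that $\operatorname{diam}(X)\le D<+\infty$ and that $X$ supports a weak local $(1,1)$-Poincaré inequality: there are a constant $\lambda\ge 1$ and a function $C_P:(0,\infty)\to(0,\infty)$ such that for every locally Lipschitz $f:X\to\mathbb R$ $$\frac{1}{\mathfrak m(B_r(x))}\int_{B_r(x)}\Big|f-f_{B_r(x)}\Big|\,d\mathfrak m\le C_P(R)\,r\,\frac{1}{\mathfrak m(B_{\lambda r}(x))}\int_{B_{\lambda r}(x)}\operatorname{lip}(f)\,d\mathfrak m\qquad\text{for all }0<r<R,\ x\in X\text{ such that } f\in L^1(B_r(x)),$$ where $f_A=\frac1{\mathfrak m(A)}\int_A f\,d\mathfrak m$ and $\operatorname{lip}(f)(x)=\limsup_{y\to x}\frac{|f(x)-f(y)|}{\mathsf d(x,y)}$ (and $\operatorname{lip}(f)(x)=0$ at isolated points $x$). No doubling condition is assumed. For $p\in(1,\infty)$ a Borel function $g:X\to[0,\infty]$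 is a $p$-weak upper gradient of $f:X\to\mathbb R$ if $|f(\gamma_a)-f(\gamma_b)|\le\int_\gamma g\,ds$ for all non-constant compact rectifiable curves $\gamma$ (with end points $\gamma_a,\gamma_b$) outside a family of zero $p$-modulus; $W^{1,p}(X)$ is the space of (classes of) functions in $L^p(\mathfrak m)$ that have a representative with a $p$-weak upper gradient in $L^p(\mathfrak m)$, and $|Df|_{p,w}$ denotes the ($\mathfrak m$-a.e.) minimal $p$-integrable $p$-weak upper gradient of $f\in W^{1,p}(X)$. Then for every $p\in(1,\infty)$ there is a constant $C>0$ such that $$\int_X|f-f_X|^p\,d\mathfrak m\le C\int_X|Df|_{p,w}^p\,d\mathfrak m\qquad\text{for all } f\in W^{1,p}(X).$$ Moreover the spectral gap $$\lambda_1(X)=\inf\Big\{\int_X|Du|_{2,w}^2\,d\mathfrak m:\ u\in W^{1,2}(X),\ \int_X u\,d\mathfrak m=0,\ \int_X u^2\,d\mathfrak m=1\Big\}\in[0,\infty]\qquad(\inf\emptyset=+\infty)$$ satisfies $\lambda_1(X)>0$. -/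

import Mathlib

open MeasureTheory Set Filter Topology
open scoped ENNReal NNReal

noncomputable section

namespace MMS

/-- The slope `lip f x = limsup_{y → x} |f x - f y| / d(x, y)`. At an isolated point the punctured
neighbourhood filter is trivial and the upper limit in `[0, ∞]` is `0`. -/
def slope {X : Type*} [MetricSpace X] (f : X → ℝ) (x : X) : ℝ≥0∞ :=
  limsup (fun y => edist (f x) (f y) / edist x y) (𝓝[≠] x)

/-- The weak local `(1,1)`-Poincaré inequality: there are `lam ≥ 1` and `CP : (0,∞) → (0,∞)` such
that the `(1,1)`-inequality holds on all balls of radius `r < R` for all locally Lipschitz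
functions (which are integrable on the ball, so that their mean value is defined). -/
def WeakLocalPoincare {X : Type*} [MetricSpace X] [MeasurableSpace X] (μ : Measure X) : Prop :=
  ∃ lam : ℝ, 1 ≤ lam ∧ ∃ CP : ℝ → ℝ≥0, (∀ R, 0 < R → 0 < CP R) ∧
    ∀ f : X → ℝ, LocallyLipschitz f →
      ∀ (R r : ℝ) (x : X), 0 < r → r < R → IntegrableOn f (Metric.ball x r) μ →
        ⨍⁻ y in Metric.ball x r, edist (f y) (⨍ z in Metric.ball x r, f z ∂μ) ∂μ ≤
          CP R * ENNReal.ofReal r * ⨍⁻ y in Metric.ball x (lam * r), slope f y ∂μ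

/-- A non-constant compact rectifiable curve, parametrized by arc length on `[a, b]`
(the values of `toFun` outside `[a, b]` are irrelevant). -/
structure RectCurve (X : Type*) [MetricSpace X] where
  a : ℝ
  b : ℝ
  lt : a < b
  toFun : ℝ → X
  unitSpeed : HasUnitSpeedOn toFun (Icc a b)

namespace RectCurve

/-- The line integral `∫_γ g ds`. -/
def lineIntegral {X : Type*} [MetricSpace X] (γ : RectCurve X) (g : X → ℝ≥0∞) : ℝ≥0∞ :=
  ∫⁻ t in Icc γ.a γ.b, g (γ.toFun t)

end RectCurve

/-- The `p`-modulus of a family of curves. -/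
def modulus {X : Type*} [MetricSpace X] [MeasurableSpace X] (p : ℝ) (μ : Measure X)
    (Γ : Set (RectCurve X)) : ℝ≥0∞ :=
  ⨅ (ρ : X → ℝ≥0∞) (_ : Measurable ρ ∧ ∀ γ ∈ Γ, 1 ≤ γ.lineIntegral ρ), ∫⁻ x, ρ x ^ p ∂μ

/-- `g` is a (Borel) `p`-weak upper gradient of the everywhere defined function `f`:
`|f(γ(a)) - f(γ(b))| ≤ ∫_γ g ds` for all curves `γ` outside a family of `p`-modulus zero. -/
def IsWeakUpperGradient {X : Type*} [MetricSpace X] [MeasurableSpace X] (p : ℝ) (μ : Measure X)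
    (f : X → ℝ) (g : X → ℝ≥0∞) : Prop :=
  Measurable g ∧
    modulus p μ {γ | ¬ edist (f (γ.toFun γ.a)) (f (γ.toFun γ.b)) ≤ γ.lineIntegral g} = 0

/-- `g` is a `p`-integrable `p`-weak upper gradient of (some representative of) the
`μ`-a.e. equivalence class of `f`. -/
def IsSobolevUpperGradient {X : Type*} [MetricSpace X] [MeasurableSpace X] (p : ℝ)
    (μ : Measure X) (f : X → ℝ) (g : X → ℝ≥0∞) : Prop :=
  ∫⁻ x, g x ^ p ∂μ < ∞ ∧ ∃ f' : X → ℝ, f' =ᵐ[μ] f ∧ IsWeakUpperGradient p μ f' g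

/-- `f` belongs to the Sobolev space `W^{1,p}(X)`. -/
def MemSobolev {X : Type*} [MetricSpace X] [MeasurableSpace X] (p : ℝ) (μ : Measure X)
    (f : X → ℝ) : Prop :=
  MemLp f (ENNReal.ofReal p) μ ∧ ∃ g, IsSobolevUpperGradient p μ f g

/-- `g` is a minimal `p`-weak upper gradient of `f`: it is, up to a null set, the smallest among
all `p`-integrable `p`-weak upper gradients. -/
def IsMinimalUpperGradient {X : Type*} [MetricSpace X] [MeasurableSpace X] (p : ℝ)
    (μ : Measure X) (f : X → ℝ) (g : X → ℝ≥0∞) : Prop :=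
  IsSobolevUpperGradient p μ f g ∧ ∀ h, IsSobolevUpperGradient p μ f h → g ≤ᵐ[μ] h

/-! ### Existence of the minimal weak upper gradient -/

section Existence

theorem ac_of_le_lintegral {h : ℝ → ℝ} {G : ℝ → ℝ≥0∞} {a b : ℝ} (hab : a < b)
    (hm : AEMeasurable G (volume.restrict (Icc a b))) (hfin : ∫⁻ t in Icc a b, G t ≠ ∞)
    (hG : ∀ s t, a ≤ s → s < t → t ≤ b → edist (h s) (h t) ≤ ∫⁻ u in Icc s t, G u) :
    AbsolutelyContinuousOnInterval h a b ∧
      ∀ᵐ t ∂(volume.restrict (Icc a b)), ‖deriv h t‖ₑ ≤ G t := by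
  set φ : ℝ → ℝ := fun t => (G t).toReal with hφ
  have hint : IntegrableOn φ (Icc a b) := integrable_toReal_of_lintegral_ne_top hm hfin
  have hII : IntervalIntegrable φ volume a b := by
    rw [intervalIntegrable_iff_integrableOn_Icc_of_le hab.le]; exact hint
  set P : ℝ → ℝ := fun t => ∫ u in a..t, φ u with hP
  have hsub : ∀ s t, a ≤ s → s < t → t ≤ b → |h t - h s| ≤ P t - P s := by
    intro s t has hst htb
    have hIs : ∀ c ∈ Icc a b, IntervalIntegrable φ volume a c := fun c hc =>
      hII.mono_set (by rw [uIcc_of_le hc.1, uIcc_of_le hab.le]; exact Icc_subset_Icc_right hc.2)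
    have hPs : P t - P s = ∫ u in s..t, φ u :=
      intervalIntegral.integral_interval_sub_left (hIs t ⟨has.trans hst.le, htb⟩)
        (hIs s ⟨has, hst.le.trans htb⟩)
    have hss : Icc s t ⊆ Icc a b := Icc_subset_Icc has htb
    have hfin' : ∫⁻ u in Icc s t, G u ≠ ∞ := ne_top_of_le_ne_top hfin (lintegral_mono_set hss)
    have hm' : AEMeasurable G (volume.restrict (Icc s t)) := hm.mono_set hss
    have h1 : ∫ u in s..t, φ u = (∫⁻ u in Icc s t, G u).toReal := by
      rw [intervalIntegral.integral_of_le hst.le, ← integral_Icc_eq_integral_Ioc,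
        integral_toReal hm' (ae_lt_top' hm' hfin')]
    rw [hPs, h1, abs_sub_comm, ← Real.dist_eq, ← ENNReal.ofReal_le_iff_le_toReal hfin',
      ← edist_dist]
    exact hG s t has hst htb
  have hsub' : ∀ s ∈ Icc a b, ∀ t ∈ Icc a b, dist (h s) (h t) ≤ dist (P s) (P t) := by
    intro s hs t ht
    rcases lt_trichotomy s t with hst | rfl | hst
    · rw [dist_comm, dist_comm (P s), Real.dist_eq, Real.dist_eq]
      exact (hsub s t hs.1 hst ht.2).trans (le_abs_self _)
    · simp
    · rw [Real.dist_eq, Real.dist_eq]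
      exact (hsub t s ht.1 hst hs.2).trans (le_abs_self _)
  have hPac : AbsolutelyContinuousOnInterval P a b :=
    hII.absolutelyContinuousOnInterval_intervalIntegral (by simp)
  have hac : AbsolutelyContinuousOnInterval h a b := by
    rw [absolutelyContinuousOnInterval_iff] at hPac ⊢
    intro ε hε
    obtain ⟨δ, hδ, H⟩ := hPac ε hε
    refine ⟨δ, hδ, fun E hE hEδ => lt_of_le_of_lt (Finset.sum_le_sum fun i hi => ?_) (H E hE hEδ)⟩
    have := hE.1 i hi
    rw [uIcc_of_le hab.le] at this
    exact hsub' _ this.1 _ this.2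
  refine ⟨hac, ?_⟩
  rw [← Measure.restrict_congr_set (Ioo_ae_eq_Icc (a := a) (b := b)),
    ae_restrict_iff' measurableSet_Ioo]
  filter_upwards [hac.ae_differentiableAt, hII.ae_hasDerivAt_integral] with x hx1 hx2 hx
  have hx' : x ∈ uIcc a b := by rw [uIcc_of_le hab.le]; exact Ioo_subset_Icc_self hx
  have d1 := (hx1 hx').hasDerivAt
  have d2 : HasDerivAt P (φ x) x := hx2 hx' a (by simp)
  have t1 := (hasDerivAt_iff_tendsto_slope.1 d1).abs.mono_left
    (show 𝓝[>] x ≤ 𝓝[≠] x from nhdsWithin_mono x fun y hy => ne_of_gt hy)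
  have t2 := (hasDerivAt_iff_tendsto_slope.1 d2).mono_left
    (show 𝓝[>] x ≤ 𝓝[≠] x from nhdsWithin_mono x fun y hy => ne_of_gt hy)
  have hle : |deriv h x| ≤ φ x := by
    refine le_of_tendsto_of_tendsto t1 t2 ?_
    filter_upwards [Ioo_mem_nhdsGT hx.2] with y hy
    rw [slope_def_field, slope_def_field, abs_div, abs_of_pos (sub_pos.2 hy.1)]
    exact div_le_div_of_nonneg_right (hsub x y hx.1.le hy.1 hy.2.le) (sub_pos.2 hy.1).le
  rw [Real.enorm_eq_ofReal_abs]
  exact (ENNReal.ofReal_le_ofReal hle).trans ENNReal.ofReal_toReal_le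

theorem edist_le_lintegral_min {h : ℝ → ℝ} {G₁ G₂ : ℝ → ℝ≥0∞} {a b : ℝ} (hab : a < b)
    (hm₁ : AEMeasurable G₁ (volume.restrict (Icc a b))) (hfin₁ : ∫⁻ t in Icc a b, G₁ t ≠ ∞)
    (hG₁ : ∀ s t, a ≤ s → s < t → t ≤ b → edist (h s) (h t) ≤ ∫⁻ u in Icc s t, G₁ u)
    (hm₂ : AEMeasurable G₂ (volume.restrict (Icc a b))) (hfin₂ : ∫⁻ t in Icc a b, G₂ t ≠ ∞)
    (hG₂ : ∀ s t, a ≤ s → s < t → t ≤ b → edist (h s) (h t) ≤ ∫⁻ u in Icc s t, G₂ u) :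
    edist (h a) (h b) ≤ ∫⁻ t in Icc a b, min (G₁ t) (G₂ t) := by
  obtain ⟨hac, h1⟩ := ac_of_le_lintegral hab hm₁ hfin₁ hG₁
  obtain ⟨-, h2⟩ := ac_of_le_lintegral hab hm₂ hfin₂ hG₂
  rw [edist_comm, edist_eq_enorm_sub, ← hac.integral_deriv_eq_sub,
    intervalIntegral.integral_of_le hab.le, ← integral_Icc_eq_integral_Ioc]
  refine (enorm_integral_le_lintegral_enorm _).trans (lintegral_mono_ae ?_)
  filter_upwards [h1, h2] with t a1 a2 using le_min a1 a2

variable {X : Type*} [MetricSpace X]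

theorem RectCurve.continuousOn (γ : RectCurve X) : ContinuousOn γ.toFun (Icc γ.a γ.b) := by
  have : LipschitzOnWith 1 γ.toFun (Icc γ.a γ.b) := by
    intro x hx y hy
    wlog hxy : x ≤ y generalizing x y
    · rw [edist_comm, edist_comm x]; exact this hy hx (le_of_not_ge hxy)
    refine (eVariationOn.edist_le γ.toFun (s := Icc γ.a γ.b ∩ Icc x y)
      ⟨hx, le_rfl, hxy⟩ ⟨hy, hxy, le_rfl⟩).trans ?_
    rw [γ.unitSpeed hx hy, edist_dist, dist_comm, Real.dist_eq, abs_of_nonneg (sub_nonneg.2 hxy)]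
    simp
  exact this.continuousOn

/-- The subcurve on `[s, t]`. -/
def RectCurve.sub (γ : RectCurve X) (s t : ℝ) (hs : γ.a ≤ s) (hst : s < t) (ht : t ≤ γ.b) :
    RectCurve X where
  a := s
  b := t
  lt := hst
  toFun := γ.toFun
  unitSpeed := by
    intro x hx y hy
    have h1 : Icc s t ∩ Icc x y = Icc γ.a γ.b ∩ Icc x y := by
      rw [inter_eq_right.2 (Icc_subset_Icc hx.1 hy.2),
        inter_eq_right.2 (Icc_subset_Icc (hs.trans hx.1) (hy.2.trans ht))]
    rw [h1]
    exact γ.unitSpeed ⟨hs.trans hx.1, hx.2.trans ht⟩ ⟨hs.trans hy.1, hy.2.trans ht⟩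

theorem RectCurve.aemeasurable_comp [MeasurableSpace X] [BorelSpace X] (γ : RectCurve X)
    {g : X → ℝ≥0∞} (hg : Measurable g) :
    AEMeasurable (fun t => g (γ.toFun t)) (volume.restrict (Icc γ.a γ.b)) :=
  hg.comp_aemeasurable (γ.continuousOn.aemeasurable measurableSet_Icc)

variable [MeasurableSpace X] {p : ℝ} {μ : Measure X}

theorem modulus_mono {Γ Γ' : Set (RectCurve X)} (h : Γ ⊆ Γ') :
    modulus p μ Γ ≤ modulus p μ Γ' :=
  le_iInf₂ fun ρ hρ => iInf₂_le ρ ⟨hρ.1, fun γ hγ => hρ.2 γ (h hγ)⟩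

theorem modulus_null_mono {Γ Γ' : Set (RectCurve X)} (h : Γ ⊆ Γ') (h0 : modulus p μ Γ' = 0) :
    modulus p μ Γ = 0 :=
  le_antisymm ((modulus_mono h).trans h0.le) bot_le

theorem modulus_iUnion_null {ι : Type} [Countable ι] (hp : 0 < p) {Γ : ι → Set (RectCurve X)}
    (h : ∀ n, modulus p μ (Γ n) = 0) : modulus p μ (⋃ n, Γ n) = 0 := by
  refine le_antisymm (le_of_forall_gt fun ε hε => ?_) bot_le
  obtain ⟨δ, hδ, hsum⟩ := ENNReal.exists_pos_sum_of_countable' hε.ne' ι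
  have : ∀ n, ∃ ρ : X → ℝ≥0∞, (Measurable ρ ∧ ∀ γ ∈ Γ n, 1 ≤ γ.lineIntegral ρ) ∧
      ∫⁻ x, ρ x ^ p ∂μ < δ n := by
    intro n
    have h1 : modulus p μ (Γ n) < δ n := by rw [h n]; exact hδ n
    simpa only [modulus, iInf_lt_iff, exists_prop] using h1
  choose ρ hρ hρδ using this
  refine lt_of_le_of_lt ?_ hsum
  refine (iInf₂_le (fun x => ⨆ n, ρ n x) ⟨Measurable.iSup fun n => (hρ n).1, ?_⟩).trans ?_
  swap
  · intro γ hγ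
    obtain ⟨n, hn⟩ := mem_iUnion.1 hγ
    exact ((hρ n).2 γ hn).trans (lintegral_mono fun t => le_iSup (fun n => ρ n (γ.toFun t)) n)
  · calc ∫⁻ x, (⨆ n, ρ n x) ^ p ∂μ ≤ ∫⁻ x, ∑' n, ρ n x ^ p ∂μ := by
          refine lintegral_mono fun x => ?_
          have := (ENNReal.orderIsoRpow p hp).map_iSup (fun n => ρ n x)
          simp only [ENNReal.orderIsoRpow_apply] at this
          rw [this]
          exact iSup_le fun n => ENNReal.le_tsum n
      _ = ∑' n, ∫⁻ x, ρ n x ^ p ∂μ :=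
          lintegral_tsum fun n => ((hρ n).1.pow_const p).aemeasurable
      _ ≤ ∑' n, δ n := ENNReal.tsum_le_tsum fun n => (hρδ n).le

theorem modulus_union_null (hp : 0 < p) {Γ Γ' : Set (RectCurve X)}
    (h : modulus p μ Γ = 0) (h' : modulus p μ Γ' = 0) : modulus p μ (Γ ∪ Γ') = 0 := by
  rw [union_eq_iUnion]
  exact modulus_iUnion_null hp fun b => by cases b <;> simpa

theorem modulus_lineIntegral_top (hp : 0 < p) {ρ : X → ℝ≥0∞} (hρ : Measurable ρ)
    (hfin : ∫⁻ x, ρ x ^ p ∂μ < ∞) : modulus p μ {γ | γ.lineIntegral ρ = ∞} = 0 := by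
  have key : ∀ n : ℕ, modulus p μ {γ | γ.lineIntegral ρ = ∞} ≤
      ((n : ℝ≥0∞)⁻¹) ^ p * ∫⁻ x, ρ x ^ p ∂μ := by
    intro n
    refine (iInf₂_le (fun x => (n : ℝ≥0∞)⁻¹ * ρ x) ⟨hρ.const_mul _, ?_⟩).trans ?_
    swap
    · intro γ hγ
      have hγ' : ∫⁻ t in Icc γ.a γ.b, ρ (γ.toFun t) = ∞ := hγ
      refine le_trans ?_ (lintegral_const_mul_le ((n : ℝ≥0∞)⁻¹) _)
      rw [hγ', ENNReal.mul_top (by simp)]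
      exact le_top
    · rw [← lintegral_const_mul _ (hρ.pow_const p)]
      exact lintegral_mono fun x => (ENNReal.mul_rpow_of_nonneg _ _ hp.le).le
  have ht : Tendsto (fun n : ℕ => ((n : ℝ≥0∞)⁻¹) ^ p * ∫⁻ x, ρ x ^ p ∂μ) atTop (𝓝 0) := by
    have h1 : Tendsto (fun n : ℕ => ((n : ℝ≥0∞)⁻¹) ^ p) atTop (𝓝 0) := by
      have := (ENNReal.continuous_rpow_const (y := p)).tendsto 0
      rw [ENNReal.zero_rpow_of_pos hp] at this
      exact this.comp ENNReal.tendsto_inv_nat_nhds_zero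
    simpa using ENNReal.Tendsto.mul_const h1 (Or.inr hfin.ne)
  exact le_antisymm (ge_of_tendsto' ht key) bot_le

theorem modulus_sub_null {Γ : Set (RectCurve X)} (h : modulus p μ Γ = 0) :
    modulus p μ {γ | ∃ s t hs hst ht, γ.sub s t hs hst ht ∈ Γ} = 0 := by
  refine le_antisymm (le_trans ?_ h.le) bot_le
  refine le_iInf₂ fun ρ hρ => iInf₂_le ρ ⟨hρ.1, ?_⟩
  rintro γ ⟨s, t, hs, hst, ht, hγ⟩
  exact (hρ.2 _ hγ).trans (lintegral_mono_set (Icc_subset_Icc hs ht))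

/-- Along almost every curve the upper gradient inequality holds on all subcurves and the upper
gradient has finite integral. -/
theorem IsWeakUpperGradient.modulus_bad (hp : 0 < p) {f : X → ℝ} {g : X → ℝ≥0∞}
    (hg : IsWeakUpperGradient p μ f g) (hfin : ∫⁻ x, g x ^ p ∂μ < ∞) :
    modulus p μ {γ | ¬ (γ.lineIntegral g ≠ ∞ ∧ ∀ s t, γ.a ≤ s → s < t → t ≤ γ.b →
      edist (f (γ.toFun s)) (f (γ.toFun t)) ≤ ∫⁻ u in Icc s t, g (γ.toFun u))} = 0 := by
  refine modulus_null_mono ?_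
    (modulus_union_null hp (modulus_lineIntegral_top hp hg.1 hfin) (modulus_sub_null hg.2))
  intro γ hγ
  by_contra hcon
  simp only [mem_union, mem_ofPred_eq, not_or] at hcon
  refine hγ ⟨hcon.1, fun s t hs hst ht => ?_⟩
  by_contra hb
  exact hcon.2 ⟨s, t, hs, hst, ht, hb⟩

variable [BorelSpace X]

theorem IsWeakUpperGradient.min (hp : 0 < p) {f : X → ℝ} {g₁ g₂ : X → ℝ≥0∞}
    (h₁ : IsWeakUpperGradient p μ f g₁) (hf₁ : ∫⁻ x, g₁ x ^ p ∂μ < ∞)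
    (h₂ : IsWeakUpperGradient p μ f g₂) (hf₂ : ∫⁻ x, g₂ x ^ p ∂μ < ∞) :
    IsWeakUpperGradient p μ f (fun x => Min.min (g₁ x) (g₂ x)) := by
  refine ⟨h₁.1.min h₂.1, modulus_null_mono ?_
    (modulus_union_null hp (h₁.modulus_bad hp hf₁) (h₂.modulus_bad hp hf₂))⟩
  intro γ hγ
  by_contra hcon
  simp only [mem_union, mem_ofPred_eq, not_or, not_not] at hcon
  obtain ⟨⟨a1, b1⟩, a2, b2⟩ := hcon
  exact hγ (edist_le_lintegral_min (h := fun t => f (γ.toFun t)) γ.lt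
    (γ.aemeasurable_comp h₁.1) a1 b1 (γ.aemeasurable_comp h₂.1) a2 b2)

theorem IsWeakUpperGradient.congr_rep (hp : 0 < p) {f₁ f₂ : X → ℝ} (hff : f₁ =ᵐ[μ] f₂)
    {g₁ g₂ : X → ℝ≥0∞}
    (h₁ : IsWeakUpperGradient p μ f₁ g₁) (hf₁ : ∫⁻ x, g₁ x ^ p ∂μ < ∞)
    (h₂ : IsWeakUpperGradient p μ f₂ g₂) (hf₂ : ∫⁻ x, g₂ x ^ p ∂μ < ∞) :
    IsWeakUpperGradient p μ f₁ g₂ := by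
  set N : Set X := toMeasurable μ {x | f₁ x ≠ f₂ x} with hN
  have hNm : MeasurableSet N := measurableSet_toMeasurable _ _
  have hN0 : μ N = 0 := by rw [hN, measure_toMeasurable]; exact hff
  set ρ : X → ℝ≥0∞ := N.indicator (fun _ => ∞) with hρ
  have hρm : Measurable ρ := measurable_const.indicator hNm
  have hρ0 : ∫⁻ x, ρ x ^ p ∂μ < ∞ := by
    have : (fun x => ρ x ^ p) =ᵐ[μ] fun _ => 0 := by
      filter_upwards [measure_eq_zero_iff_ae_notMem.1 hN0] with x hx
      simp [hρ, hx, hp]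
    rw [lintegral_congr_ae this]; simp
  refine ⟨h₂.1, modulus_null_mono ?_ (modulus_union_null hp (modulus_union_null hp
    (h₁.modulus_bad hp hf₁) (h₂.modulus_bad hp hf₂)) (modulus_lineIntegral_top hp hρm hρ0))⟩
  intro γ hγ
  by_contra hcon
  simp only [mem_union, mem_ofPred_eq, not_or, not_not] at hcon
  obtain ⟨⟨⟨a1, b1⟩, a2, b2⟩, c⟩ := hcon
  have cont1 := (ac_of_le_lintegral (h := fun t => f₁ (γ.toFun t)) γ.lt
    (γ.aemeasurable_comp h₁.1) a1 b1).1.continuousOn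
  have cont2 := (ac_of_le_lintegral (h := fun t => f₂ (γ.toFun t)) γ.lt
    (γ.aemeasurable_comp h₂.1) a2 b2).1.continuousOn
  rw [uIcc_of_le γ.lt.le] at cont1 cont2
  have hae : (fun t => f₁ (γ.toFun t)) =ᵐ[volume.restrict (Icc γ.a γ.b)]
      fun t => f₂ (γ.toFun t) := by
    filter_upwards [ae_lt_top' (γ.aemeasurable_comp hρm) c] with t ht
    by_contra hne
    have : γ.toFun t ∈ N := subset_toMeasurable _ _ hne
    simp [hρ, this] at ht
  have heq := Measure.eqOn_Icc_of_ae_eq volume γ.lt.ne hae cont1 cont2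
  have ea := heq (left_mem_Icc.2 γ.lt.le)
  have eb := heq (right_mem_Icc.2 γ.lt.le)
  simp only at ea eb
  apply hγ
  rw [ea, eb]
  exact b2 _ _ le_rfl γ.lt le_rfl

theorem IsWeakUpperGradient.iInf (hp : 0 < p) {f : X → ℝ} {g : ℕ → X → ℝ≥0∞}
    (h : ∀ n, IsWeakUpperGradient p μ f (g n)) (hanti : Antitone g)
    (hfin : ∫⁻ x, g 0 x ^ p ∂μ < ∞) :
    IsWeakUpperGradient p μ f (fun x => ⨅ n, g n x) := by
  refine ⟨Measurable.iInf fun n => (h n).1, modulus_null_mono ?_ (modulus_union_null hp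
    (modulus_iUnion_null hp fun n => (h n).2) (modulus_lineIntegral_top hp (h 0).1 hfin))⟩
  intro γ hγ
  by_contra hcon
  simp only [mem_union, mem_iUnion, mem_ofPred_eq, not_or, not_exists, not_not] at hcon
  apply hγ
  have : γ.lineIntegral (fun x => ⨅ n, g n x) = ⨅ n, γ.lineIntegral (g n) :=
    lintegral_iInf' (fun n => γ.aemeasurable_comp (h n).1)
      (ae_of_all _ fun t m n hmn => hanti hmn _) hcon.2
  rw [this]
  exact le_iInf hcon.1

theorem IsSobolevUpperGradient.min (hp : 0 < p) {f : X → ℝ} {g₁ g₂ : X → ℝ≥0∞}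
    (h₁ : IsSobolevUpperGradient p μ f g₁) (h₂ : IsSobolevUpperGradient p μ f g₂) :
    IsSobolevUpperGradient p μ f (fun x => Min.min (g₁ x) (g₂ x)) := by
  obtain ⟨i₁, f₁, e₁, w₁⟩ := h₁
  obtain ⟨i₂, f₂, e₂, w₂⟩ := h₂
  refine ⟨lt_of_le_of_lt (lintegral_mono fun x => ?_) i₁, f₁, e₁,
    w₁.min hp i₁ (w₁.congr_rep hp (e₁.trans e₂.symm) i₁ w₂ i₂) i₂⟩
  exact ENNReal.rpow_le_rpow (min_le_left _ _) hp.le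

/-- Every function with a `p`-integrable `p`-weak upper gradient has a minimal one. -/
theorem exists_isMinimalUpperGradient (hp : 0 < p) {f : X → ℝ}
    (hf : ∃ g, IsSobolevUpperGradient p μ f g) : ∃ g, IsMinimalUpperGradient p μ f g := by
  set S : Set ℝ≥0∞ := (fun g : X → ℝ≥0∞ => ∫⁻ x, g x ^ p ∂μ) ''
    {g | IsSobolevUpperGradient p μ f g} with hS
  have hne : S.Nonempty := by
    obtain ⟨g, hg⟩ := hf
    exact ⟨_, g, hg, rfl⟩
  obtain ⟨v, -, hv, hvS⟩ := exists_seq_tendsto_sInf hne (OrderBot.bddBelow S)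
  choose u hu huv using hvS
  let g : ℕ → X → ℝ≥0∞ := fun n => Nat.rec (u 0) (fun k G x => Min.min (G x) (u (k + 1) x)) n
  have hgs : ∀ n, IsSobolevUpperGradient p μ f (g n) := by
    intro n
    induction n with
    | zero => exact hu 0
    | succ k ih => exact ih.min hp (hu (k + 1))
  have hanti : Antitone g := antitone_nat_of_succ_le fun n x => min_le_left _ _
  have hgu : ∀ n x, g n x ≤ u n x := by
    intro n x
    cases n with
    | zero => exact le_rfl
    | succ k => exact min_le_right _ _
  set G : X → ℝ≥0∞ := fun x => ⨅ n, g n x with hG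
  have hGle : ∀ n, ∫⁻ x, G x ^ p ∂μ ≤ v n := by
    intro n
    rw [← huv n]
    exact lintegral_mono fun x =>
      ENNReal.rpow_le_rpow ((iInf_le (fun n => g n x) n).trans (hgu n x)) hp.le
  have hGinf : ∫⁻ x, G x ^ p ∂μ ≤ sInf S := ge_of_tendsto' hv hGle
  have hGs : IsSobolevUpperGradient p μ f G := by
    obtain ⟨i₀, f₀, e₀, w₀⟩ := hgs 0
    refine ⟨lt_of_le_of_lt (lintegral_mono fun x =>
      ENNReal.rpow_le_rpow (iInf_le (fun n => g n x) 0) hp.le) i₀, f₀, e₀,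
      IsWeakUpperGradient.iInf hp (fun n => ?_) hanti i₀⟩
    obtain ⟨i, f', e, w⟩ := hgs n
    exact w₀.congr_rep hp (e₀.trans e.symm) i₀ w i
  refine ⟨G, hGs, fun h hh => ?_⟩
  have hm := hGs.min hp hh
  have hle : ∫⁻ x, G x ^ p ∂μ ≤ ∫⁻ x, Min.min (G x) (h x) ^ p ∂μ :=
    hGinf.trans (sInf_le ⟨_, hm, rfl⟩)
  obtain ⟨iG, fG, eG, wG⟩ := hGs
  have hae := ae_eq_of_ae_le_of_lintegral_le
    (ae_of_all μ fun x => ENNReal.rpow_le_rpow (min_le_left (G x) (h x)) hp.le)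
    hm.1.ne (wG.1.pow_const p).aemeasurable hle
  filter_upwards [hae] with x hx
  exact min_eq_left_iff.1 (ENNReal.rpow_left_injective hp.ne' hx)

end Existence

/-- The minimal `p`-weak upper gradient `|Df|_{p,w}` of `f ∈ W^{1,p}(X)` (it exists by
`exists_isMinimalUpperGradient` and is unique up to null sets; outside `W^{1,p}(X)` the value is
irrelevant). -/
def minimalUpperGradient {X : Type*} [MetricSpace X] [MeasurableSpace X] (p : ℝ)
    (μ : Measure X) (f : X → ℝ) : X → ℝ≥0∞ :=
  open Classical in
  if h : ∃ g, IsMinimalUpperGradient p μ f g then h.choose else 0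

theorem isMinimalUpperGradient_minimalUpperGradient {X : Type*} [MetricSpace X]
    [MeasurableSpace X] [BorelSpace X] {p : ℝ} (hp : 0 < p) {μ : Measure X} {f : X → ℝ}
    (hf : MemSobolev p μ f) : IsMinimalUpperGradient p μ f (minimalUpperGradient p μ f) := by
  have h := exists_isMinimalUpperGradient hp hf.2
  rw [minimalUpperGradient, dif_pos h]
  exact h.choose_spec

/-- The spectral gap `λ₁(X)` of a metric measure space of finite measure, as an element of
`[0, ∞]`; the infimum of the empty set (for a one-point space, say) is `∞`. -/
def spectralGap {X : Type*} [MetricSpace X] [MeasurableSpace X] (μ : Measure X) : ℝ≥0∞ :=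
  ⨅ (u : X → ℝ) (_ : MemSobolev 2 μ u ∧ ∫ x, u x ∂μ = 0 ∧ ∫ x, u x ^ 2 ∂μ = 1),
    ∫⁻ x, minimalUpperGradient 2 μ u x ^ 2 ∂μ

end MMS

end

/-! Since the diameter is at most `D`, a ball of radius larger than `D` is all of `X`, so the local
inequality becomes a global `(1,1)`-inequality (`WeakLocalPoincare.exists_globalPoincare`). For
Lipschitz `v` it is applied to `sign(v - c) |v - c|^p`, with `c` chosen so that this power has mean
zero; the chain rule and Hölder give a `(p,p)`-inequality (`GlobalPoincare.oscillation_le`). Mean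
values are replaced by the double integral `oscillation`, which passes to a.e. limits by Fatou
alone.

It remains to reach Sobolev functions without doubling, hence without the usual discrete
convolutions. Let `0 ≤ f ≤ M` have weak upper gradient `g`. Up to a small error and the factor `2 ^
(p - 1)` in the energy, `g` is replaced by a lower semicontinuous `H`, bounded away from zero, with
compact sublevel sets, that is an upper gradient along every curve
(`IsWeakUpperGradient.exists_coercive`). Choose a lower semicontinuous `F ≥ f` with almost the same
integral. Embed `X` in `ℓ^∞`, let `H` be infinite off `X`, and approximate it from below by the
Lipschitz functions `lipReg H n`. The value functions with running cost `lipReg H n` and terminal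
cost `F` are Lipschitz on `X` with slope at most `lipReg H n ≤ H`, so the `(p,p)`-inequality applies
to them. They increase to some `U ≤ F`. Coercivity makes nearly optimal curves converge to a curve
of cost at most `U` (`exists_curve_le_iSup_valueFun`); finite cost keeps it inside `X`, where the
upper gradient inequality gives `f ≤ U` (`exists_oscillation_le`).

As the errors tend to zero, the functions `U`, squeezed between `f` and `F`, converge to `f` a.e.
Truncation removes the boundedness. The spectral gap bound is the case `p = 2`. -/

namespace MMS

/-! ### Lipschitz approximation of a lower semicontinuous cost from below. -/

section InfConvolution

variable {E : Type*} [PseudoEMetricSpace E] {H : E → ℝ≥0∞}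

/-- The Lipschitz regularization of `min H n` from below. -/
noncomputable def lipReg (H : E → ℝ≥0∞) (n : ℕ) (x : E) : ℝ≥0∞ :=
  ⨅ y, (min (H y) n + n * edist x y)

theorem lipReg_le_add (n : ℕ) (x y : E) : lipReg H n x ≤ lipReg H n y + n * edist x y := by
  rw [lipReg, lipReg, ENNReal.iInf_add]
  refine le_iInf fun z => (iInf_le _ z).trans ?_
  rw [add_assoc, ← mul_add, add_comm (edist y z)]
  gcongr
  exact edist_triangle x y z

theorem lipReg_le_self (n : ℕ) (x : E) : lipReg H n x ≤ H x :=
  (iInf_le _ x).trans (by simp)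

theorem lipReg_le_natCast (n : ℕ) (x : E) : lipReg H n x ≤ n :=
  (iInf_le _ x).trans (by simp)

theorem lipReg_mono {m n : ℕ} (h : m ≤ n) (x : E) : lipReg H m x ≤ lipReg H n x :=
  iInf_mono fun y => by gcongr

/-- Competitors within distance `r` already have a value of at least `a`; those farther away pay the
penalty `n * r`. -/
theorem le_lipReg {n : ℕ} {x : E} {a r : ℝ≥0∞} (h : ∀ y, edist x y < r → a ≤ H y) (han : a ≤ n)
    (hr : a ≤ n * r) : a ≤ lipReg H n x := by
  refine le_iInf fun y => ?_
  rcases lt_or_ge (edist x y) r with hy | hy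
  · exact (le_min (h y hy) han).trans le_self_add
  · exact (hr.trans (by gcongr)).trans le_add_self

theorem iSup_lipReg (hH : LowerSemicontinuous H) (x : E) : ⨆ n, lipReg H n x = H x := by
  refine le_antisymm (iSup_le fun n => lipReg_le_self n x) (le_of_forall_lt fun a ha => ?_)
  obtain ⟨b, hab, hb⟩ := exists_between ha
  refine hab.trans_le ?_
  obtain ⟨r, hr, hball⟩ := EMetric.mem_nhds_iff.1 (hH x b hb)
  obtain ⟨n₁, hn₁⟩ := ENNReal.exists_nat_gt hb.ne_top
  obtain ⟨n₂, hn₂⟩ := ENNReal.exists_nat_mul_gt hr.ne' hb.ne_top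
  refine le_trans (le_lipReg (n := max n₁ n₂) (r := r) (fun y hy => ?_) ?_ ?_)
    (le_iSup (fun n => lipReg H n x) (max n₁ n₂))
  · exact (hball (by rwa [Metric.mem_eball, edist_comm])).le
  · exact hn₁.le.trans (by exact_mod_cast le_max_left _ _)
  · exact hn₂.le.trans (by gcongr; exact le_max_right _ _)

theorem continuous_lipReg (n : ℕ) : Continuous (lipReg H n) :=
  continuous_of_le_add_edist n (ENNReal.natCast_ne_top n) fun x y => lipReg_le_add n x y

end InfConvolution

/-! ### Value functions of a minimal cost problem for curves. -/

section ValueFunction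

theorem lipschitzWith_ite_concat {Y : Type*} [PseudoMetricSpace Y] {s c : ℝ → Y} {d : ℝ} (hs : LipschitzWith 1 s)
    (hc : LipschitzWith 1 c) (h : s d = c 0) :
    LipschitzWith 1 (fun t => if t ≤ d then s t else c (t - d)) := by
  have key : ∀ t u, t ≤ u → dist ((fun t => if t ≤ d then s t else c (t - d)) t)
      ((fun t => if t ≤ d then s t else c (t - d)) u) ≤ u - t := by
    intro t u htu
    have ls : ∀ a b, dist (s a) (s b) ≤ |a - b| := fun a b => by
      simpa [Real.dist_eq] using hs.dist_le_mul a b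
    have lc : ∀ a b, dist (c a) (c b) ≤ |a - b| := fun a b => by
      simpa [Real.dist_eq] using hc.dist_le_mul a b
    by_cases h1 : t ≤ d <;> by_cases h2 : u ≤ d
    · simp only [h1, h2, if_true]
      refine (ls _ _).trans ?_
      rw [abs_sub_comm, abs_of_nonneg (by linarith)]
    · simp only [h1, h2, if_true, if_false]
      refine (dist_triangle _ (s d) _).trans ?_
      nth_rewrite 2 [h]
      refine (add_le_add (ls _ _) (lc _ _)).trans ?_
      rw [abs_sub_comm, abs_of_nonneg (by linarith), abs_sub_comm, abs_of_nonneg (by linarith)]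
      linarith
    · exact absurd (htu.trans h2) h1
    · simp only [h1, h2, if_false]
      refine (lc _ _).trans ?_
      rw [abs_sub_comm, abs_of_nonneg (by linarith)]
      linarith
  refine LipschitzWith.of_dist_le_mul fun t u => ?_
  rw [NNReal.coe_one, one_mul, Real.dist_eq]
  rcases le_total t u with htu | htu
  · rw [abs_sub_comm, abs_of_nonneg (by linarith)]
    exact key t u htu
  · rw [dist_comm, abs_of_nonneg (by linarith)]
    exact key u t htu

variable {E : Type*} [NormedAddCommGroup E]

/-- The least cost `F (c T) + ∫₀ᵀ G (c t) dt` of a curve `c` of speed at most `1` that starts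
at `x`. -/
noncomputable def valueFun (F G : E → ℝ≥0∞) (x : E) : ℝ≥0∞ :=
  ⨅ (c : ℝ → E) (T : ℝ) (_ : LipschitzWith 1 c ∧ c 0 = x ∧ 0 ≤ T),
    (F (c T) + ∫⁻ t in Icc 0 T, G (c t))

variable {F G : E → ℝ≥0∞}

theorem valueFun_le {c : ℝ → E} {T : ℝ} (hc : LipschitzWith 1 c) (hT : 0 ≤ T) :
    valueFun F G (c 0) ≤ F (c T) + ∫⁻ t in Icc 0 T, G (c t) :=
  iInf₂_le_of_le c T (iInf_le _ ⟨hc, rfl, hT⟩)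

theorem valueFun_le_self (x : E) : valueFun F G x ≤ F x := by
  simpa using valueFun_le (F := F) (G := G) (c := fun _ => x) (T := 0)
    (LipschitzWith.const' x) le_rfl

theorem exists_of_valueFun_lt {x : E} {a : ℝ≥0∞} (h : valueFun F G x < a) :
    ∃ (c : ℝ → E) (T : ℝ), LipschitzWith 1 c ∧ c 0 = x ∧ 0 ≤ T ∧
      F (c T) + ∫⁻ t in Icc 0 T, G (c t) < a := by
  simpa only [valueFun, iInf_lt_iff, exists_prop, and_assoc] using h

theorem valueFun_mono {G' : E → ℝ≥0∞} (h : G ≤ G') (x : E) : valueFun F G x ≤ valueFun F G' x := by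
  unfold valueFun
  gcongr
  exact h _

variable [NormedSpace ℝ E]

/-- The path that runs along a segment from `y` to `x` with unit speed. -/
theorem exists_segment_path (x y : E) : ∃ s : ℝ → E, LipschitzWith 1 s ∧ s 0 = y ∧
    s (dist x y) = x ∧ ∀ t ∈ Icc 0 (dist x y), dist x (s t) ≤ dist x y := by
  rcases eq_or_ne x y with rfl | hxy
  · exact ⟨fun _ => x, LipschitzWith.const' x, rfl, rfl, by simp⟩
  have hd : 0 < dist x y := dist_pos.2 hxy
  refine ⟨fun t => y + (t / dist x y) • (x - y), ?_, by simp, ?_, ?_⟩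
  · refine LipschitzWith.of_dist_le_mul fun s t => ?_
    rw [dist_add_left, dist_eq_norm, ← sub_smul, norm_smul, ← dist_eq_norm x y, ← sub_div,
      norm_div, Real.norm_of_nonneg hd.le, div_mul_cancel₀ _ hd.ne', Real.dist_eq]
    simp
  · simp [div_self hd.ne']
  · rintro t ⟨ht0, ht⟩
    have h1 : x - (y + (t / dist x y) • (x - y)) = (1 - t / dist x y) • (x - y) := by
      rw [sub_smul, one_smul]; abel
    have h2 : t / dist x y ≤ 1 := div_le_one_of_le₀ ht hd.le
    have h3 : 0 ≤ t / dist x y := div_nonneg ht0 hd.le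
    rw [dist_eq_norm x (_ + _), h1, norm_smul, Real.norm_of_nonneg (by linarith),
      ← dist_eq_norm]
    exact mul_le_of_le_one_left hd.le (by linarith)

/-- From `y`, run along the segment to `x` and then follow a nearly optimal curve from `x`. On the
segment the running cost exceeds `G x` by at most `n * edist x y`. This is where segments, and hence
an ambient normed space, are needed. -/
theorem valueFun_le_add {n : ℕ} (hG : ∀ x y, G x ≤ G y + n * edist x y) (x y : E) :
    valueFun F G y ≤ valueFun F G x + edist x y * (G x + n * edist x y) := by
  refine ENNReal.le_of_forall_pos_le_add fun ε hε hfin => ?_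
  have hx : valueFun F G x ≠ ∞ := ne_top_of_le_ne_top hfin.ne le_self_add
  obtain ⟨c, T, hc, hc0, hT, hlt⟩ := exists_of_valueFun_lt
    (ENNReal.lt_add_right hx (ENNReal.coe_ne_zero.2 hε.ne'))
  obtain ⟨s, hs, hs0, hsd, hsx⟩ := exists_segment_path x y
  set d := dist x y with hd
  have hd0 : 0 ≤ d := dist_nonneg
  set k : ℝ → E := fun t => if t ≤ d then s t else c (t - d) with hk
  have hkL : LipschitzWith 1 k := lipschitzWith_ite_concat hs hc (hsd.trans hc0.symm)
  have hk0 : k 0 = y := by simp [hk, hd0, hs0]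
  have hkT : k (d + T) = c T := by
    rcases hT.eq_or_lt with rfl | hT'
    · simp [hk, hsd, hc0]
    · simp [hk, hT']
  have h1 := valueFun_le (F := F) (G := G) hkL (add_nonneg hd0 hT)
  rw [hk0, hkT] at h1
  have h2 : ∫⁻ t in Icc 0 (d + T), G (k t) ≤
      (∫⁻ t in Icc 0 d, G (k t)) + ∫⁻ t in Ioc d (d + T), G (k t) := by
    rw [← Icc_union_Ioc_eq_Icc hd0 (by linarith : d ≤ d + T)]
    exact lintegral_union_le _ _ _
  have h3 : ∫⁻ t in Icc 0 d, G (k t) ≤ edist x y * (G x + n * edist x y) := by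
    calc ∫⁻ t in Icc 0 d, G (k t) ≤ ∫⁻ t in Icc 0 d, (G x + n * edist x y) := by
          refine setLIntegral_mono measurable_const fun t ht => ?_
          have : k t = s t := by simp [hk, ht.2]
          rw [this]
          refine (hG _ x).trans ?_
          gcongr
          rw [edist_comm, edist_dist, edist_dist]
          exact ENNReal.ofReal_le_ofReal (hsx t ht)
      _ = _ := by
          rw [setLIntegral_const, Real.volume_Icc, sub_zero, hd, ← edist_dist, mul_comm]
  have h4 : ∫⁻ t in Ioc d (d + T), G (k t) ≤ ∫⁻ t in Icc 0 T, G (c t) := by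
    have e1 : ∫⁻ t in Ioc d (d + T), G (k t) = ∫⁻ t in Ioc d (d + T), G (c (t - d)) := by
      refine setLIntegral_congr_fun measurableSet_Ioc fun t ht => ?_
      simp only [hk, if_neg (not_le.2 ht.1)]
    have e2 : ∫⁻ t in Ioc d (d + T), G (c (t - d)) = ∫⁻ t in Ioc 0 T, G (c t) := by
      rw [← lintegral_indicator measurableSet_Ioc, ← lintegral_indicator measurableSet_Ioc,
        ← lintegral_sub_right_eq_self (fun t => (Ioc 0 T).indicator (fun t => G (c t)) t) d]
      refine lintegral_congr fun t => ?_
      simp only [indicator, mem_Ioc, sub_pos, sub_le_iff_le_add']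
    rw [e1, e2]
    exact lintegral_mono_set Ioc_subset_Icc_self
  calc valueFun F G y ≤ F (c T) + ((∫⁻ t in Icc 0 d, G (k t)) +
        ∫⁻ t in Ioc d (d + T), G (k t)) := h1.trans (by gcongr)
    _ ≤ F (c T) + (edist x y * (G x + n * edist x y) + ∫⁻ t in Icc 0 T, G (c t)) := by gcongr
    _ = (F (c T) + ∫⁻ t in Icc 0 T, G (c t)) + edist x y * (G x + n * edist x y) := by ring
    _ ≤ (valueFun F G x + ε) + edist x y * (G x + n * edist x y) := by gcongr
    _ = _ := by ring

/-- The slope at `x` needs both one-sided bounds in terms of `G x`; moving the base point from `y`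
to `x` only doubles the second-order term. -/
theorem valueFun_le_add_swap {n : ℕ} (hG : ∀ x y, G x ≤ G y + n * edist x y) (x y : E) :
    valueFun F G x ≤ valueFun F G y + edist x y * (G x + 2 * n * edist x y) := by
  refine (valueFun_le_add hG y x).trans ?_
  rw [edist_comm y x]
  refine add_le_add_right (mul_le_mul_right ?_ _) _
  calc G y + n * edist x y ≤ G x + n * edist y x + n * edist x y := by gcongr; exact hG y x
    _ = G x + 2 * n * edist x y := by rw [edist_comm y x]; ring

end ValueFunction

end MMS

/-! ### Compactness of curves of bounded cost and lower semicontinuity of the cost. -/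

namespace MMS

theorem ennreal_liminf_add_le_liminf_add (u v : ℕ → ℝ≥0∞) :
    liminf u atTop + liminf v atTop ≤ liminf (fun n => u n + v n) atTop := by
  simp only [liminf_eq_iSup_iInf_of_nat]
  rw [ENNReal.iSup_add_iSup_of_monotone]
  · exact iSup_mono fun n => le_iInf₂ fun i hi =>
      add_le_add (iInf₂_le i hi) (iInf₂_le i hi)
  · exact fun m n h => biInf_mono fun i hi => h.trans hi
  · exact fun m n h => biInf_mono fun i hi => h.trans hi

section LimitCurve

variable {E : Type*} [MetricSpace E] {H : E → ℝ≥0∞}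

/-- Curves of bounded cost that start at a common point have a totally bounded union, if the
limit cost has compact sublevel sets. -/
theorem totallyBounded_iUnion_image {A : ℝ≥0∞} (hA : A ≠ ∞)
    (hH : ∀ a : ℕ, IsCompact {y | H y ≤ a}) {x : E} {c : ℕ → ℝ → E} {T : ℕ → ℝ}
    (hc : ∀ n, LipschitzWith 1 (c n)) (hc0 : ∀ n, c n 0 = x)
    (hcost : ∀ n, ∫⁻ t in Icc 0 (T n), lipReg H n (c n t) ≤ A) :
    TotallyBounded (⋃ n, c n '' Icc 0 (T n)) := by
  refine Metric.totallyBounded_iff.2 fun ε hε => ?_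
  have hε4 : ENNReal.ofReal (ε / 4) ≠ 0 := by simpa using hε
  obtain ⟨a, ha⟩ := ENNReal.exists_nat_mul_gt hε4 hA
  obtain ⟨N₁, hN₁⟩ := ENNReal.exists_nat_mul_gt hε4 (ENNReal.natCast_ne_top a)
  -- A point `c n u` with `n ≥ N` lies within `ε / 2` of `K`. Otherwise, during the time `[u - ε /
  -- 4, u]` the curve stays at distance at least `ε / 4` from the sublevel set at `a`, so its
  -- running cost is at least `a`, and `a * (ε / 4) > A`. Adding `x` to `K` ensures `u ≥ ε / 2`, so
  -- that this time interval lies in the domain.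
  set N := max a N₁ with hN
  set K : Set E := ({y | H y ≤ a} ∪ {x}) ∪ ⋃ n ∈ Finset.range N, c n '' Icc 0 (T n) with hK
  have hKc : IsCompact K :=
    ((hH a).union isCompact_singleton).union ((Finset.range N).isCompact_biUnion fun n _ =>
      isCompact_Icc.image (hc n).continuous)
  obtain ⟨t, ht, hKt⟩ := Metric.totallyBounded_iff.1 hKc.totallyBounded (ε / 2) (half_pos hε)
  refine ⟨t, ht, ?_⟩
  suffices hS : ∀ q ∈ ⋃ n, c n '' Icc 0 (T n), ∃ z ∈ K, dist q z < ε / 2 by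
    intro q hq
    obtain ⟨z, hz, hqz⟩ := hS q hq
    obtain ⟨y, hy, hzy⟩ := mem_iUnion₂.1 (hKt hz)
    refine mem_iUnion₂.2 ⟨y, hy, ?_⟩
    have := dist_triangle q z y
    rw [Metric.mem_ball] at hzy ⊢
    linarith
  intro q hq
  obtain ⟨n, u, hu, rfl⟩ := mem_iUnion.1 hq
  rcases lt_or_ge n N with hn | hn
  · refine ⟨c n u, Or.inr (mem_iUnion₂.2 ⟨n, Finset.mem_range.2 hn, mem_image_of_mem _ hu⟩), ?_⟩
    simpa using half_pos hε
  by_contra! hfar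
  have hlip : ∀ s s', dist (c n s) (c n s') ≤ |s - s'| := fun s s' => by
    simpa [Real.dist_eq] using (hc n).dist_le_mul s s'
  have hu1 : ε / 2 ≤ u := by
    have h1 := hfar x (Or.inl (Or.inr rfl))
    have h2 := hlip u 0
    rw [hc0, sub_zero, abs_of_nonneg hu.1] at h2
    exact h1.trans h2
  have hlow : ∀ s ∈ Icc (u - ε / 4) u, (a : ℝ≥0∞) ≤ lipReg H n (c n s) := by
    intro s hs
    refine le_lipReg (r := ENNReal.ofReal (ε / 4)) (fun y hy => ?_) ?_ ?_
    · by_contra! hya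
      have h1 := hfar y (Or.inl (Or.inl hya.le))
      have h2 := hlip u s
      rw [abs_of_nonneg (by linarith [hs.2])] at h2
      rw [edist_dist, ENNReal.ofReal_lt_ofReal_iff (by positivity)] at hy
      have h3 := dist_triangle (c n u) (c n s) y
      linarith [hs.1]
    · exact_mod_cast (le_max_left _ _).trans hn
    · refine hN₁.le.trans ?_
      gcongr
      exact (le_max_right _ _).trans hn
  have : (a : ℝ≥0∞) * ENNReal.ofReal (ε / 4) ≤ A := by
    calc (a : ℝ≥0∞) * ENNReal.ofReal (ε / 4) = ∫⁻ _ in Icc (u - ε / 4) u, (a : ℝ≥0∞) := by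
          rw [setLIntegral_const, Real.volume_Icc, sub_sub_cancel]
      _ ≤ ∫⁻ s in Icc (u - ε / 4) u, lipReg H n (c n s) :=
          setLIntegral_mono' measurableSet_Icc hlow
      _ ≤ ∫⁻ s in Icc 0 (T n), lipReg H n (c n s) :=
          lintegral_mono_set (Icc_subset_Icc (by linarith) hu.2)
      _ ≤ A := hcost n
  exact absurd ha (not_lt.2 this)

/-- A sequence of curves of speed at most `1` in a compact set, defined on intervals of bounded
length, has a convergent subsequence. -/
theorem exists_subseq_tendsto_curve {K : Set E} (hK : IsCompact K) {L : ℝ} (hL : 0 ≤ L)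
    {c : ℕ → ℝ → E} {T : ℕ → ℝ} (hc : ∀ n, LipschitzWith 1 (c n)) (hcK : ∀ n t, c n t ∈ K)
    (hT : ∀ n, T n ∈ Icc 0 L) :
    ∃ (k : ℝ → E) (τ : ℝ) (φ : ℕ → ℕ), StrictMono φ ∧ LipschitzWith 1 k ∧ τ ∈ Icc 0 L ∧
      (∀ t ∈ Icc 0 L, Tendsto (fun n => c (φ n) t) atTop (𝓝 (k t))) ∧
      Tendsto (fun n => T (φ n)) atTop (𝓝 τ) ∧
      Tendsto (fun n => c (φ n) (T (φ n))) atTop (𝓝 (k τ)) := by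
  set A : Set (BoundedContinuousFunction (Icc 0 L) E) :=
    {f | LipschitzWith 1 f ∧ ∀ t, f t ∈ K} with hAdef
  have hev : ∀ t : Icc 0 L, Continuous fun f : BoundedContinuousFunction (Icc 0 L) E => f t :=
    fun t => continuous_eval_const t
  have hAclosed : IsClosed A := by
    have : A = (⋂ s, ⋂ t, {f | edist (f s) (f t) ≤ edist s t}) ∩ ⋂ t, {f | f t ∈ K} := by
      ext f
      simp only [hAdef, LipschitzWith, ENNReal.coe_one, one_mul, mem_ofPred_eq, mem_inter_iff,
        mem_iInter]
    rw [this]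
    refine (isClosed_iInter fun s => isClosed_iInter fun t => ?_).inter
      (isClosed_iInter fun t => hK.isClosed.preimage (hev t))
    exact isClosed_le ((hev s).edist (hev t)) continuous_const
  have hAc : IsCompact A := by
    refine BoundedContinuousFunction.arzela_ascoli₂ K hK A hAclosed (fun f t hf => hf.2 t) ?_
    exact (LipschitzWith.uniformEquicontinuous _ 1 fun f => f.2.1).equicontinuous
  let f : ℕ → BoundedContinuousFunction (Icc 0 L) E := fun n =>
    BoundedContinuousFunction.mkOfCompact ⟨fun t => c n t, (hc n).continuous.comp
      continuous_subtype_val⟩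
  have hfA : ∀ n, f n ∈ A := fun n => ⟨fun s t => hc n s t, fun t => hcK n t⟩
  obtain ⟨⟨k, τ⟩, ⟨hkA, -⟩, φ, hφ, hlim⟩ := (hAc.prod (isCompact_univ (X := Icc 0 L))).tendsto_subseq
    (x := fun n => (f n, (⟨T n, hT n⟩ : Icc 0 L))) fun n => ⟨hfA n, mem_univ _⟩
  have hlim1 : Tendsto (fun n => f (φ n)) atTop (𝓝 k) :=
    (continuous_fst.tendsto _).comp hlim
  have hlim2 : Tendsto (fun n => (⟨T (φ n), hT (φ n)⟩ : Icc 0 L)) atTop (𝓝 τ) :=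
    (continuous_snd.tendsto _).comp hlim
  refine ⟨fun t => k (projIcc 0 L hL t), τ, φ, hφ, ?_, τ.2, fun t ht => ?_,
    (continuous_subtype_val.tendsto _).comp hlim2, ?_⟩
  · have := hkA.1.comp (LipschitzWith.projIcc hL)
    rwa [one_mul] at this
  · beta_reduce
    rw [projIcc_of_mem hL ht]
    exact ((hev ⟨t, ht⟩).tendsto k).comp hlim1
  · beta_reduce
    rw [projIcc_val]
    exact hlim1.eval hlim2

/-- For fixed `m` the continuous function `lipReg H m` is below `lipReg H (φ n)` for all large `n`;
then take the supremum over `m`. -/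
theorem le_liminf_lipReg (hH : LowerSemicontinuous H) {φ : ℕ → ℕ} (hφ : StrictMono φ)
    {y : ℕ → E} {z : E} (hy : Tendsto y atTop (𝓝 z)) :
    H z ≤ liminf (fun n => lipReg H (φ n) (y n)) atTop := by
  rw [← iSup_lipReg hH z]
  refine iSup_le fun m => ?_
  have h1 : Tendsto (fun n => lipReg H m (y n)) atTop (𝓝 (lipReg H m z)) :=
    ((continuous_lipReg m).tendsto z).comp hy
  rw [← h1.liminf_eq]
  refine liminf_le_liminf ?_
  filter_upwards [eventually_ge_atTop m] with n hn
  exact lipReg_mono (hn.trans hφ.le_apply) _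

end LimitCurve

/-- As the running costs `lipReg H n` increase to `H`, nearly optimal curves converge to a curve
whose cost is at most the limit of the value functions. -/
theorem exists_curve_le_iSup_valueFun {E : Type*} [NormedAddCommGroup E] [CompleteSpace E]
    {F H : E → ℝ≥0∞} {x : E} (hF : LowerSemicontinuous F) (hFx : F x ≠ ∞)
    (hH : ∀ a : ℕ, IsCompact {y | H y ≤ a}) (hHl : LowerSemicontinuous H)
    {δ : ℝ≥0∞} (hδ : δ ≠ 0) (hδH : ∀ y, δ ≤ H y) :
    ∃ (c : ℝ → E) (T : ℝ), LipschitzWith 1 c ∧ c 0 = x ∧ 0 ≤ T ∧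
      F (c T) + ∫⁻ t in Icc 0 T, H (c t) ≤ ⨆ n, valueFun F (lipReg H n) x := by
  set s := ⨆ n, valueFun F (lipReg H n) x with hs
  have hsfin : s ≠ ∞ := ne_top_of_le_ne_top hFx (iSup_le fun n => valueFun_le_self x)
  have hstep : ∀ n : ℕ, ∃ (c : ℝ → E) (T : ℝ), LipschitzWith 1 c ∧ c 0 = x ∧ 0 ≤ T ∧
      F (c T) + ∫⁻ t in Icc 0 T, lipReg H n (c t) < s + ((n : ℝ≥0∞) + 1)⁻¹ := fun n =>
    exists_of_valueFun_lt <| (le_iSup (fun n => valueFun F (lipReg H n) x) n).trans_lt <|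
      ENNReal.lt_add_right hsfin (by simp)
  choose c T hc hc0 hT hcost using hstep
  have hcostA : ∀ n, ∫⁻ t in Icc 0 (T n), lipReg H n (c n t) ≤ s + 1 := fun n =>
    (le_add_self.trans (hcost n).le).trans (by gcongr; simp)
  have hA : s + 1 ≠ ∞ := by simpa using hsfin
  -- For `n ≥ 1` the running cost is at least `δ'`, so bounded cost bounds the time by `L`. For `n =
  -- 0` the running cost vanishes; hence the shift to `n + 1` below.
  set δ' := min δ 1 with hδ'
  have hδ'0 : δ' ≠ 0 := by simp [hδ', hδ]
  have hδ'fin : δ' ≠ ∞ := ne_top_of_le_ne_top ENNReal.one_ne_top (min_le_right _ _)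
  set L := ((s + 1) / δ').toReal with hL
  have hTL : ∀ n, 1 ≤ n → T n ≤ L := by
    intro n hn
    have h1 : δ' * ENNReal.ofReal (T n) ≤ s + 1 := by
      refine le_trans ?_ (hcostA n)
      rw [← sub_zero (T n), ← Real.volume_Icc, ← setLIntegral_const, sub_zero]
      refine lintegral_mono fun t => le_lipReg (r := ∞) (fun y _ => ?_) ?_ ?_
      · exact (min_le_left _ _).trans (hδH y)
      · exact (min_le_right _ _).trans (by exact_mod_cast hn)
      · rw [ENNReal.mul_top (by simp; omega)]; exact le_top
    rw [hL, ← ENNReal.ofReal_le_iff_le_toReal (ENNReal.div_ne_top hA hδ'0),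
      ENNReal.le_div_iff_mul_le (Or.inl hδ'0) (Or.inl hδ'fin), mul_comm]
    exact h1
  set K := closure (⋃ n, c n '' Icc 0 (T n)) with hK
  have hKc : IsCompact K :=
    (totallyBounded_iUnion_image hA hH hc hc0 hcostA).closure.isCompact_of_isClosed isClosed_closure
  -- The curves are stopped at their end points so that they stay in `K` for all times.
  let k : ℕ → ℝ → E := fun n t => c (n + 1) (projIcc 0 (T (n + 1)) (hT _) t)
  have hkeq : ∀ n, ∀ t ∈ Icc 0 (T (n + 1)), k n t = c (n + 1) t := fun n t ht => by
    simp only [k, projIcc_of_mem (hT (n + 1)) ht]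
  obtain ⟨κ, τ, φ, hφ, hκ, hτ, hpt, hTτ, hend⟩ := exists_subseq_tendsto_curve (c := k)
    (T := fun n => T (n + 1)) hKc (L := L) ENNReal.toReal_nonneg
    (fun n => by
      have := (hc (n + 1)).comp ((LipschitzWith.subtype_val (Icc 0 (T (n + 1)))).comp
        (LipschitzWith.projIcc (hT (n + 1))))
      rwa [one_mul, one_mul] at this)
    (fun n t => subset_closure (mem_iUnion.2 ⟨n + 1, mem_image_of_mem _ (projIcc _ _ _ t).2⟩))
    (fun n => ⟨hT _, hTL _ (by omega)⟩)
  have hL0 : (0 : ℝ) ∈ Icc 0 L := ⟨le_rfl, ENNReal.toReal_nonneg⟩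
  refine ⟨κ, τ, hκ, ?_, hτ.1, ?_⟩
  · refine tendsto_nhds_unique (hpt 0 hL0) ?_
    have : ∀ n, k (φ n) 0 = x := fun n => by rw [hkeq _ _ ⟨le_rfl, hT _⟩, hc0]
    simp [this]
  set I : ℕ → ℝ≥0∞ := fun n =>
    ∫⁻ t in Icc 0 (T (φ n + 1)), lipReg H (φ n + 1) (k (φ n) t) with hI
  have hFliminf : F (κ τ) ≤ liminf (fun n => F (k (φ n) (T (φ n + 1)))) atTop :=
    (lowerSemicontinuousAt_iff_le_liminf.1 (hF (κ τ))).trans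
      (liminf_le_liminf_of_le hend |>.trans (le_of_eq (by rw [← liminf_comp]; rfl)))
  have hIliminf : ∫⁻ t in Icc 0 τ, H (κ t) ≤ liminf I atTop := by
    -- The end point is dropped because only `t < τ` guarantees that `t` eventually lies in the
    -- domain of the approximating curves.
    have e1 : ∫⁻ t in Icc 0 τ, H (κ t) = ∫⁻ t, (Ico 0 τ).indicator (fun t => H (κ t)) t := by
      rw [lintegral_indicator measurableSet_Ico, setLIntegral_congr Ico_ae_eq_Icc]
    have e2 : ∀ n, I n = ∫⁻ t, (Icc 0 (T (φ n + 1))).indicator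
        (fun t => lipReg H (φ n + 1) (k (φ n) t)) t := fun n => by
      rw [lintegral_indicator measurableSet_Icc]
    rw [e1, funext e2]
    refine le_trans (lintegral_mono fun t => ?_) (lintegral_liminf_le fun n => ?_)
    · by_cases ht : t ∈ Ico 0 τ
      · rw [indicator_of_mem ht]
        refine (le_liminf_lipReg hHl (φ := fun n => φ n + 1) (fun a b h => by simpa using hφ h)
          (hpt t ⟨ht.1, ht.2.le.trans hτ.2⟩)).trans (liminf_le_liminf ?_)
        filter_upwards [hTτ.eventually (lt_mem_nhds ht.2)] with n hn
        rw [indicator_of_mem (show t ∈ Icc 0 (T (φ n + 1)) from ⟨ht.1, hn.le⟩)]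
      · rw [indicator_of_notMem ht]; exact bot_le
    · refine Measurable.indicator ?_ measurableSet_Icc
      refine ((continuous_lipReg _).comp ?_).measurable
      exact (hc _).continuous.comp (continuous_subtype_val.comp continuous_projIcc)
  have hsum : ∀ n, F (k (φ n) (T (φ n + 1))) + I n ≤ s + (((φ n + 1 : ℕ) : ℝ≥0∞) + 1)⁻¹ := by
    intro n
    rw [hkeq _ _ ⟨hT _, le_rfl⟩, hI]
    simp only
    rw [setLIntegral_congr_fun measurableSet_Icc (g := fun t => lipReg H (φ n + 1) (c (φ n + 1) t))
      fun t ht => by simp only [hkeq _ _ ht]]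
    exact (hcost _).le
  have hlim : Tendsto (fun n => s + (((φ n + 1 : ℕ) : ℝ≥0∞) + 1)⁻¹) atTop (𝓝 s) := by
    have h1 : Tendsto (fun n : ℕ => (((φ n + 1 : ℕ) : ℝ≥0∞) + 1)⁻¹) atTop (𝓝 0) := by
      have := ENNReal.tendsto_inv_nat_nhds_zero.comp
        ((tendsto_add_atTop_nat 2).comp hφ.tendsto_atTop)
      refine this.congr fun n => ?_
      simp only [Function.comp]
      norm_cast
    simpa using tendsto_const_nhds.add h1
  calc F (κ τ) + ∫⁻ t in Icc 0 τ, H (κ t)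
      ≤ liminf (fun n => F (k (φ n) (T (φ n + 1)))) atTop + liminf I atTop := by gcongr
    _ ≤ liminf (fun n => F (k (φ n) (T (φ n + 1))) + I n) atTop := ennreal_liminf_add_le_liminf_add _ _
    _ ≤ liminf (fun n => s + (((φ n + 1 : ℕ) : ℝ≥0∞) + 1)⁻¹) atTop :=
        liminf_le_liminf (Eventually.of_forall hsum)
    _ = s := hlim.liminf_eq

end MMS

/-! ### Arc length parametrization. -/

namespace MMS

/-- Lebesgue measure on the image of a `1`-Lipschitz function is at most the push-forward of
Lebesgue measure. -/
theorem restrict_image_le_map {s : ℝ → ℝ} {A : Set ℝ}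
    (hs : LipschitzOnWith 1 s A) (hsm : AEMeasurable s (volume.restrict A)) :
    (volume.restrict (s '' A)) ≤ Measure.map s (volume.restrict A) := by
  refine Measure.le_iff.2 fun B hB => ?_
  rw [Measure.restrict_apply hB, Measure.map_apply_of_aemeasurable hsm hB,
    ← image_preimage_inter]
  refine le_trans ?_ (Measure.le_restrict_apply _ _)
  -- Lebesgue measure is the one-dimensional Hausdorff measure, which a `1`-Lipschitz map does not
  -- increase.
  rw [← hausdorffMeasure_real]
  simpa using (hs.mono (s := s ⁻¹' B ∩ A) inter_subset_right).hausdorffMeasure_image_le zero_le_one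

/-- The arc length parametrization of a curve of speed at most `1`. -/
theorem exists_rectCurve {X : Type*} [MetricSpace X] [MeasurableSpace X] [BorelSpace X]
    {c : ℝ → X} {T : ℝ} (hT : 0 ≤ T) (hc : LipschitzOnWith 1 c (Icc 0 T)) (hne : c 0 ≠ c T)
    {h : X → ℝ≥0∞} (hh : Measurable h) :
    ∃ γ : RectCurve X, γ.toFun γ.a = c 0 ∧ γ.toFun γ.b = c T ∧
      γ.lineIntegral h ≤ ∫⁻ t in Icc 0 T, h (c t) := by
  set I := Icc 0 T with hI
  have h0 : (0 : ℝ) ∈ I := ⟨le_rfl, hT⟩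
  have hTI : T ∈ I := ⟨hT, le_rfl⟩
  have hvar : ∀ x y, x ∈ I → y ∈ I → eVariationOn c (I ∩ Icc x y) ≤ ENNReal.ofReal (y - x) := by
    intro x y hx hy
    have h1 := hc.comp_eVariationOn_le (g := id) (s := I ∩ Icc x y) (fun t ht => ht.1)
    rw [Function.comp_id, ENNReal.coe_one, one_mul] at h1
    exact h1.trans ((eVariationOn.mono _ inter_subset_right).trans (eVariationOn_id_Icc x y).le)
  have hbv : LocallyBoundedVariationOn c I := fun x y hx hy =>
    ne_top_of_le_ne_top ENNReal.ofReal_ne_top (hvar x y hx hy)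
  set s := variationOnFromTo c I 0 with hs
  have hs0 : s 0 = 0 := variationOnFromTo.self _ _ _
  have hsmono : MonotoneOn s I := variationOnFromTo.monotoneOn hbv h0
  have hslip : LipschitzOnWith 1 s I := by
    have key : ∀ x ∈ I, ∀ y ∈ I, x ≤ y → |s x - s y| ≤ y - x := by
      intro x hx y hy hxy
      rw [abs_sub_comm, abs_of_nonneg (sub_nonneg.2 (hsmono hx hy hxy)),
        sub_le_iff_le_add', hs,
        ← variationOnFromTo.add hbv h0 hx hy, variationOnFromTo.eq_of_le _ _ hxy]
      gcongr
      exact ENNReal.toReal_le_of_le_ofReal (by linarith) (hvar x y hx hy)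
    refine LipschitzOnWith.of_dist_le_mul fun x hx y hy => ?_
    rw [NNReal.coe_one, one_mul, Real.dist_eq, Real.dist_eq]
    rcases le_total x y with hxy | hxy
    · rw [abs_sub_comm x, abs_of_nonneg (sub_nonneg.2 hxy)]
      exact key x hx y hy hxy
    · rw [abs_sub_comm, abs_of_nonneg (sub_nonneg.2 hxy)]
      exact key y hy x hx hxy
  have himage : s '' I = Icc 0 (s T) := by
    refine Subset.antisymm ?_ ?_
    · rintro _ ⟨t, ht, rfl⟩
      exact ⟨hs0 ▸ hsmono h0 ht ht.1, hsmono ht hTI ht.2⟩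
    · have := intermediate_value_Icc hT hslip.continuousOn
      rwa [hs0] at this
  set N := naturalParameterization c I 0 with hN
  have hNs : ∀ t ∈ I, N (s t) = c t := fun t ht =>
    edist_eq_zero.1 (edist_naturalParameterization_eq_zero hbv h0 ht)
  have hspeed : HasUnitSpeedOn N (Icc 0 (s T)) := by
    rw [← himage]
    exact has_unit_speed_naturalParameterization c hbv h0
  have hpos : 0 < s T := by
    refine lt_of_le_of_ne (hs0 ▸ hsmono h0 hTI hT) fun h => hne ?_
    rw [← hNs 0 h0, ← hNs T hTI, hs0, ← h]
  let γ : RectCurve X := ⟨0, s T, hpos, N, hspeed⟩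
  refine ⟨γ, ?_, hNs T hTI, ?_⟩
  · change N 0 = c 0
    rw [← hNs 0 h0, hs0]
  have hsm : AEMeasurable s (volume.restrict I) :=
    hslip.continuousOn.aemeasurable measurableSet_Icc
  have hle := restrict_image_le_map hslip hsm
  rw [himage] at hle
  -- The natural parametrization is controlled only on `[0, s T]`; extending it constantly makes the
  -- integrand measurable on the whole line.
  set k : ℝ → ℝ≥0∞ := fun t => h (IccExtend hpos.le (domRestrict (Icc 0 (s T)) N) t) with hk
  have hkm : Measurable k :=
    hh.comp (γ.continuousOn.domRestrict.Icc_extend' : Continuous (IccExtend hpos.le _)).measurable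
  have hkN : ∀ t ∈ Icc 0 (s T), k t = h (N t) := fun t ht => by
    simp only [hk, IccExtend_of_mem _ _ ht, domRestrict_apply]
  calc γ.lineIntegral h = ∫⁻ t in Icc 0 (s T), k t :=
        setLIntegral_congr_fun measurableSet_Icc fun t ht => (hkN t ht).symm
    _ ≤ ∫⁻ t, k t ∂(Measure.map s (volume.restrict I)) := lintegral_mono' hle le_rfl
    _ = ∫⁻ t in I, k (s t) := lintegral_map' hkm.aemeasurable hsm
    _ = ∫⁻ t in I, h (c t) := setLIntegral_congr_fun measurableSet_Icc fun t ht => by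
        rw [hkN _ (himage ▸ mem_image_of_mem s ht), hNs t ht]

end MMS

/-! ### Odd powers, and the oscillation as a double integral. -/

namespace MMS

section SignedPow

/-- The odd power `s ↦ sign(s) |s|^p`. -/
noncomputable def signedPow (p s : ℝ) : ℝ := s * |s| ^ (p - 1)

variable {p : ℝ}

theorem abs_signedPow (hp : 0 < p) (s : ℝ) : |signedPow p s| = |s| ^ p := by
  rcases eq_or_ne s 0 with rfl | hs
  · simp [signedPow, Real.zero_rpow hp.ne']
  · rw [signedPow, abs_mul, abs_of_nonneg (Real.rpow_nonneg (abs_nonneg s) _),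
      Real.rpow_sub_one (abs_ne_zero.2 hs), mul_div_cancel₀ _ (abs_ne_zero.2 hs)]

theorem signedPow_neg (s : ℝ) : signedPow p (-s) = -signedPow p s := by
  simp [signedPow]

theorem signedPow_nonneg {s : ℝ} (hs : 0 ≤ s) : 0 ≤ signedPow p s := by
  unfold signedPow; positivity

theorem continuous_signedPow (hp : 1 < p) : Continuous (signedPow p) :=
  continuous_id.mul (continuous_abs.rpow_const fun _ => Or.inr (by linarith))

/-- Bernoulli's inequality for `b / a`, multiplied by `a ^ p`. -/
theorem rpow_sub_rpow_le (hp : 1 ≤ p) {a b : ℝ} (hb : 0 ≤ b) (hba : b ≤ a) :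
    a ^ p - b ^ p ≤ p * a ^ (p - 1) * (a - b) := by
  rcases (hb.trans hba).eq_or_lt with rfl | ha
  · obtain rfl : b = 0 := le_antisymm hba hb
    simp
  have h1 := one_add_mul_self_le_rpow_one_add (s := b / a - 1)
    (by linarith [div_nonneg hb ha.le]) hp
  rw [add_sub_cancel, Real.div_rpow hb ha.le, le_div_iff₀ (Real.rpow_pos_of_pos ha p)] at h1
  have h2 : a ^ p = a ^ (p - 1) * a := by
    rw [Real.rpow_sub_one ha.ne', div_mul_cancel₀ _ ha.ne']
  have h3 : (1 + p * (b / a - 1)) * a ^ p = a ^ p - p * a ^ (p - 1) * (a - b) := by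
    rw [h2]; field_simp; ring
  linarith

theorem abs_signedPow_sub_le (hp : 1 ≤ p) (a b : ℝ) :
    |signedPow p a - signedPow p b| ≤ p * max |a| |b| ^ (p - 1) * |a - b| := by
  wlog hab : |b| ≤ |a| generalizing a b
  · rw [abs_sub_comm, max_comm, abs_sub_comm a]
    exact this b a (le_of_not_ge hab)
  wlog ha : 0 ≤ a generalizing a b
  · have := this (-a) (-b) (by simpa using hab) (by linarith)
    rw [signedPow_neg, signedPow_neg, abs_neg, abs_neg] at this
    rwa [← abs_neg, ← abs_neg (a - b), neg_sub', neg_sub']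
  rw [max_eq_left hab]
  rw [abs_of_nonneg ha] at hab ⊢
  have hpow : ∀ s : ℝ, 0 ≤ s → signedPow p s = s ^ p := fun s hs => by
    rw [← abs_of_nonneg (signedPow_nonneg hs), abs_signedPow (by linarith), abs_of_nonneg hs]
  rcases le_total 0 b with hb | hb
  · rw [abs_of_nonneg hb] at hab
    rw [hpow a ha, hpow b hb, abs_of_nonneg (sub_nonneg.2 (Real.rpow_le_rpow hb hab (by linarith))),
      abs_of_nonneg (sub_nonneg.2 hab)]
    exact rpow_sub_rpow_le hp hb hab
  · have e : |signedPow p a - signedPow p b| ≤ a ^ (p - 1) * |a - b| := by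
      have hb' : |b| ^ (p - 1) ≤ a ^ (p - 1) :=
        Real.rpow_le_rpow (abs_nonneg _) hab (by linarith)
      have h0 := signedPow_nonneg (p := p) ha
      have h1 := signedPow_nonneg (p := p) (neg_nonneg.2 hb)
      rw [signedPow_neg] at h1
      rw [abs_of_nonneg (by linarith), abs_of_nonneg (by linarith), signedPow, signedPow,
        abs_of_nonneg ha]
      nlinarith
    refine e.trans ?_
    rw [mul_assoc]
    exact le_mul_of_one_le_left (by positivity) hp

end SignedPow

section Oscillation

variable {X : Type*} [MeasurableSpace X] {μ : Measure X} {p : ℝ}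

/-- The `p`-th power of the mean oscillation, as a double integral. -/
noncomputable def oscillation (p : ℝ) (μ : Measure X) (f : X → ℝ) : ℝ≥0∞ :=
  ∫⁻ x, ∫⁻ y, edist (f x) (f y) ^ p ∂μ ∂μ

theorem oscillation_le (hp : 1 ≤ p) {f : X → ℝ} (hf : Measurable f) (c : ℝ) :
    oscillation p μ f ≤ 2 ^ p * μ univ * ∫⁻ x, edist (f x) c ^ p ∂μ := by
  have hm : Measurable fun x => edist (f x) c ^ p := (hf.edist measurable_const).pow_const p
  set a := ∫⁻ x, edist (f x) c ^ p ∂μ with ha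
  calc oscillation p μ f
      ≤ ∫⁻ x, ∫⁻ y, 2 ^ (p - 1) * (edist (f x) c ^ p + edist (f y) c ^ p) ∂μ ∂μ := by
        refine lintegral_mono fun x => lintegral_mono fun y => ?_
        refine le_trans ?_ (ENNReal.rpow_add_le_mul_rpow_add_rpow _ _ hp)
        exact ENNReal.rpow_le_rpow (edist_triangle_right _ _ _) (by linarith)
    _ = ∫⁻ x, 2 ^ (p - 1) * (edist (f x) c ^ p * μ univ + a) ∂μ := by
        refine lintegral_congr fun x => ?_
        rw [lintegral_const_mul _ (hm.const_add _), lintegral_add_left measurable_const,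
          lintegral_const]
    _ = 2 ^ (p - 1) * (a * μ univ + a * μ univ) := by
        rw [lintegral_const_mul _ ((hm.mul_const _).add_const _),
          lintegral_add_left (hm.mul_const _), lintegral_mul_const _ hm, lintegral_const]
    _ = 2 ^ p * μ univ * a := by
        have : (2 : ℝ≥0∞) ^ p = 2 ^ (p - 1) * 2 := by
          conv_rhs => rw [← ENNReal.rpow_one 2, ← ENNReal.rpow_mul, one_mul,
            ← ENNReal.rpow_add _ _ two_ne_zero ENNReal.ofNat_ne_top]
          ring_nf
        rw [this]; ring

/-- Jensen's inequality for the average over `y`, obtained from Hölder against the constant `1`. -/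
theorem lintegral_edist_average_le [IsFiniteMeasure μ] (hp : 1 < p) {f : X → ℝ}
    (hf : Integrable f μ) (hμ : μ ≠ 0) :
    ∫⁻ x, edist (f x) (⨍ y, f y ∂μ) ^ p ∂μ ≤ (μ univ)⁻¹ * oscillation p μ f := by
  have hμ0 : μ univ ≠ 0 := by simpa using hμ
  have hμt : μ univ ≠ ∞ := measure_ne_top μ univ
  rw [oscillation, ← lintegral_const_mul' _ _ (ENNReal.inv_ne_top.2 hμ0)]
  refine lintegral_mono fun x => ?_
  have hm : AEMeasurable (fun y => edist (f x) (f y)) μ :=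
    aemeasurable_const.edist hf.aemeasurable
  have h1 : edist (f x) (⨍ y, f y ∂μ) ≤ (μ univ)⁻¹ * ∫⁻ y, edist (f x) (f y) ∂μ := by
    have e : f x - ⨍ y, f y ∂μ = ⨍ y, (f x - f y) ∂μ := by
      rw [average_eq, average_eq, integral_sub (integrable_const _) hf, integral_const, smul_sub,
        smul_smul, inv_mul_cancel₀, one_smul]
      simp [measureReal_def, ENNReal.toReal_eq_zero_iff, hμ, hμt]
    rw [edist_eq_enorm_sub, e, ← lintegral_const_mul' _ _ (ENNReal.inv_ne_top.2 hμ0), average]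
    refine (enorm_integral_le_lintegral_enorm _).trans (le_of_eq ?_)
    rw [lintegral_smul_measure, smul_eq_mul, lintegral_const_mul' _ _ (ENNReal.inv_ne_top.2 hμ0)]
    simp only [edist_eq_enorm_sub]
  have hpq : p.HolderConjugate (p / (p - 1)) := Real.HolderConjugate.conjExponent hp
  have h2 := ENNReal.lintegral_mul_le_Lp_mul_Lq μ hpq hm (aemeasurable_const (b := 1))
  simp only [Pi.mul_apply, mul_one, ENNReal.one_rpow, lintegral_const, one_mul] at h2
  calc edist (f x) (⨍ y, f y ∂μ) ^ p
      ≤ ((μ univ)⁻¹ * ((∫⁻ y, edist (f x) (f y) ^ p ∂μ) ^ (1 / p) *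
          μ univ ^ (1 / (p / (p - 1))))) ^ p :=
        ENNReal.rpow_le_rpow (h1.trans (by gcongr)) (by linarith)
    _ = (μ univ)⁻¹ * ∫⁻ y, edist (f x) (f y) ^ p ∂μ := by
        have hp0 : p ≠ 0 := by linarith
        have hp1 : p - 1 ≠ 0 := by linarith
        rw [ENNReal.mul_rpow_of_nonneg _ _ (by linarith), ENNReal.mul_rpow_of_nonneg _ _ (by linarith),
          ← ENNReal.rpow_mul, ← ENNReal.rpow_mul, one_div_mul_cancel hp0, ENNReal.rpow_one,
          show 1 / (p / (p - 1)) * p = p + (-1) by field_simp; ring, ENNReal.rpow_add _ _ hμ0 hμt,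
          ENNReal.inv_rpow, ENNReal.rpow_neg_one]
        have hm1 : (μ univ ^ p)⁻¹ * μ univ ^ p = 1 := ENNReal.inv_mul_cancel
          (ENNReal.rpow_pos (pos_iff_ne_zero.2 hμ0) hμt).ne' (ENNReal.rpow_ne_top_of_nonneg (by linarith) hμt)
        rw [← one_mul ((μ univ)⁻¹ * _), ← hm1]
        ring

/-- Fatou in each variable. No convergence of mean values is involved, so no domination is needed.
-/
theorem oscillation_le_liminf {f : X → ℝ} {F : ℕ → X → ℝ} (hF : ∀ n, AEMeasurable (F n) μ)
    [SFinite μ]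
    (hlim : ∀ᵐ x ∂μ, Tendsto (fun n => F n x) atTop (𝓝 (f x))) :
    oscillation p μ f ≤ liminf (fun n => oscillation p μ (F n)) atTop := by
  have hm : ∀ n, AEMeasurable (Function.uncurry fun x y => edist (F n x) (F n y) ^ p)
      (μ.prod μ) := fun n =>
    ((hF n).comp_fst.edist (hF n).comp_snd).pow_const p
  calc oscillation p μ f
      ≤ ∫⁻ x, liminf (fun n => ∫⁻ y, edist (F n x) (F n y) ^ p ∂μ) atTop ∂μ := by
        refine lintegral_mono_ae ?_
        filter_upwards [hlim] with x hx
        refine le_trans (lintegral_mono_ae ?_) (lintegral_liminf_le' fun n =>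
          (aemeasurable_const.edist (hF n)).pow_const p)
        filter_upwards [hlim] with y hy
        exact (((ENNReal.continuous_rpow_const (y := p)).tendsto _).comp
          (hx.edist hy)).liminf_eq.ge
    _ ≤ liminf (fun n => oscillation p μ (F n)) atTop :=
        lintegral_liminf_le' fun n => (hm n).lintegral_prod_right'

end Oscillation

end MMS

/-! ### The `(p,p)`-inequality for Lipschitz functions. -/

namespace MMS

variable {X : Type*} [MetricSpace X] {p : ℝ}

theorem slope_le_of_edist_le {w : X → ℝ} {x : X} {Q : X → ℝ≥0∞} {q : ℝ≥0∞}
    (hQ : Tendsto Q (𝓝 x) (𝓝 q)) (h : ∀ y, edist (w x) (w y) ≤ Q y * edist x y) :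
    slope w x ≤ q := by
  rcases (𝓝[≠] x).eq_or_neBot with hbot | hne
  · simp [slope, hbot]
  · rw [slope, ← (hQ.mono_left (nhdsWithin_le_nhds (s := {x}ᶜ))).limsup_eq]
    exact limsup_le_limsup (Eventually.of_forall fun y => ENNReal.div_le_of_le_mul (h y))

/-- A chain rule; the second-order term `k * edist x y ^ 2` does not contribute to the slope. -/
theorem slope_signedPow_le (hp : 1 < p) {v : X → ℝ} (hv : Continuous v) (c : ℝ) {x : X}
    {g k : ℝ≥0∞} (hg : g ≠ ∞) (hk : k ≠ ∞)
    (h : ∀ y, edist (v x) (v y) ≤ edist x y * (g + k * edist x y)) :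
    slope (fun x => signedPow p (v x - c)) x ≤
      ENNReal.ofReal p * (edist (v x) c ^ (p - 1) * g) := by
  have hp1 : 0 ≤ p - 1 := by linarith
  refine slope_le_of_edist_le (Q := fun y => ENNReal.ofReal (p * max |v x - c| |v y - c| ^ (p - 1)) *
    (g + k * edist x y)) ?_ fun y => ?_
  · have h1 : Continuous fun y => ENNReal.ofReal (p * max |v x - c| |v y - c| ^ (p - 1)) := by
      refine ENNReal.continuous_ofReal.comp (continuous_const.mul ?_)
      exact (continuous_const.max (hv.sub continuous_const).abs).rpow_const
        fun _ => Or.inr hp1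
    have h2 : Tendsto (fun y => g + k * edist x y) (𝓝 x) (𝓝 g) := by
      have h3 : Tendsto (fun y => edist x y) (𝓝 x) (𝓝 0) := by
        simpa using (continuous_const.edist continuous_id : Continuous fun y => edist x y).tendsto x
      simpa using tendsto_const_nhds.add (ENNReal.Tendsto.const_mul h3 (Or.inr hk))
    convert! ENNReal.Tendsto.mul (h1.tendsto x) (Or.inr hg) h2 (Or.inr ENNReal.ofReal_ne_top) using 2
    rw [max_self, ENNReal.ofReal_mul (by linarith), ← ENNReal.ofReal_rpow_of_nonneg (abs_nonneg _) hp1,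
      ← Real.dist_eq, ← edist_dist, mul_assoc]
  · calc edist (signedPow p (v x - c)) (signedPow p (v y - c))
        ≤ ENNReal.ofReal (p * max |v x - c| |v y - c| ^ (p - 1)) * edist (v x) (v y) := by
          rw [edist_dist, edist_dist, ← ENNReal.ofReal_mul (by positivity), Real.dist_eq, Real.dist_eq]
          refine ENNReal.ofReal_le_ofReal ((abs_signedPow_sub_le hp.le _ _).trans (le_of_eq ?_))
          rw [sub_sub_sub_cancel_right]
      _ ≤ _ := by
          rw [mul_assoc, mul_comm _ (edist x y)]
          gcongr
          exact h y

theorem lipschitzWith_signedPow_comp (hp : 1 < p) {v : X → ℝ} {K : ℝ≥0} (hv : LipschitzWith K v)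
    {c M : ℝ} (hM : ∀ x, |v x - c| ≤ M) :
    LipschitzWith (Real.toNNReal (p * M ^ (p - 1)) * K) fun x => signedPow p (v x - c) := by
  refine LipschitzWith.of_dist_le_mul fun x y => ?_
  have hM0 : 0 ≤ M := (abs_nonneg _).trans (hM x)
  rw [NNReal.coe_mul, Real.coe_toNNReal _ (by positivity), Real.dist_eq, mul_assoc]
  refine (abs_signedPow_sub_le hp.le _ _).trans ?_
  rw [sub_sub_sub_cancel_right, ← Real.dist_eq (v x) (v y)]
  gcongr
  · exact max_le (hM x) (hM y)
  · exact hv.dist_le_mul x y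

variable [MeasurableSpace X] {μ : Measure X}

/-- Intermediate value theorem in `c`: the integrand is nonnegative for `c = 0` and nonpositive for
`c = M`. -/
theorem exists_integral_signedPow_eq_zero [BorelSpace X] [IsFiniteMeasure μ] (hp : 1 < p)
    {v : X → ℝ} (hv : Measurable v) {M : ℝ} (hM : 0 ≤ M) (hvM : ∀ x, v x ∈ Icc 0 M) :
    ∃ c ∈ Icc 0 M, ∫ x, signedPow p (v x - c) ∂μ = 0 := by
  have hcont : ContinuousOn (fun c => ∫ x, signedPow p (v x - c) ∂μ) (Icc 0 M) := by
    refine continuousOn_of_dominated (bound := fun _ => M ^ p) (fun c _ =>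
      ((continuous_signedPow hp).measurable.comp (hv.sub_const c)).aestronglyMeasurable)
      (fun c hc => Eventually.of_forall fun x => ?_) (integrable_const _)
      (Eventually.of_forall fun x => ?_)
    · rw [Real.norm_eq_abs, abs_signedPow (by linarith)]
      refine Real.rpow_le_rpow (abs_nonneg _) (abs_le.2 ⟨?_, ?_⟩) (by linarith)
      · linarith [(hvM x).1, hc.2]
      · linarith [(hvM x).2, hc.1]
    · exact ((continuous_signedPow hp).comp (continuous_const.sub continuous_id)).continuousOn
  have h0 : 0 ≤ ∫ x, signedPow p (v x - 0) ∂μ :=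
    integral_nonneg fun x => signedPow_nonneg (by simpa using (hvM x).1)
  have h1 : ∫ x, signedPow p (v x - M) ∂μ ≤ 0 := by
    refine integral_nonpos fun x => ?_
    have := signedPow_nonneg (p := p) (sub_nonneg.2 (hvM x).2)
    rw [← neg_sub, signedPow_neg] at this
    exact neg_nonneg.1 this
  obtain ⟨c, hc, hc0⟩ := intermediate_value_Icc' hM hcont ⟨h1, h0⟩
  exact ⟨c, hc, hc0⟩

/-- The power of `a` on the right is absorbed by division, which requires `a` to be finite. -/
theorem le_of_le_mul_rpow_mul_rpow (hp : 1 < p) {a b K : ℝ≥0∞} (ha : a ≠ ∞)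
    (h : a ≤ K * (a ^ (1 / (p / (p - 1))) * b ^ (1 / p))) : a ≤ K ^ p * b := by
  rcases eq_or_ne a 0 with rfl | ha0
  · exact bot_le
  have hp0 : 0 < p := by linarith
  have hp1 : p - 1 ≠ 0 := by linarith
  have e : a = a ^ (1 / (p / (p - 1))) * a ^ (1 / p) := by
    rw [← ENNReal.rpow_add _ _ ha0 ha, show 1 / (p / (p - 1)) + 1 / p = 1 by field_simp; ring,
      ENNReal.rpow_one]
  have hne : a ^ (1 / (p / (p - 1))) ≠ 0 := (ENNReal.rpow_pos (pos_iff_ne_zero.2 ha0) ha).ne'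
  have hnt : a ^ (1 / (p / (p - 1))) ≠ ∞ :=
    ENNReal.rpow_ne_top_of_nonneg (one_div_nonneg.2 (div_nonneg hp0.le (by linarith))) ha
  have h1 : a ^ (1 / p) ≤ K * b ^ (1 / p) := by
    rw [← ENNReal.mul_le_mul_iff_right hne hnt, ← e]
    exact h.trans (le_of_eq (by ring))
  have h2 := ENNReal.rpow_le_rpow h1 hp0.le
  rwa [ENNReal.mul_rpow_of_nonneg _ _ hp0.le, ← ENNReal.rpow_mul, ← ENNReal.rpow_mul,
    one_div_mul_cancel hp0.ne', ENNReal.rpow_one, ENNReal.rpow_one] at h2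

/-- The global `(1,1)`-Poincaré inequality with constant `A`. -/
def GlobalPoincare (A : ℝ≥0∞) (μ : Measure X) : Prop :=
  ∀ w : X → ℝ, LocallyLipschitz w → Integrable w μ →
    ∫⁻ y, edist (w y) (⨍ z, w z ∂μ) ∂μ ≤ A * ∫⁻ y, slope w y ∂μ

theorem WeakLocalPoincare.exists_globalPoincare [IsFiniteMeasure μ] (hμ : μ ≠ 0) {D : ℝ}
    (hD : ∀ x y : X, dist x y ≤ D) (hP : WeakLocalPoincare μ) :
    ∃ A : ℝ≥0∞, A ≠ ∞ ∧ GlobalPoincare A μ := by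
  obtain ⟨lam, hlam, CP, -, h⟩ := hP
  have hμ0 : μ univ ≠ 0 := by simpa using hμ
  have hμt : μ univ ≠ ∞ := measure_ne_top μ univ
  obtain ⟨x⟩ : Nonempty X := by
    by_contra hX
    rw [not_nonempty_iff] at hX
    exact hμ0 (by rw [univ_eq_empty_iff.2 hX, measure_empty])
  set r := |D| + 1 with hr
  have hr0 : 0 < r := by positivity
  have hball : ∀ s, r ≤ s → Metric.ball x s = univ := fun s hs => eq_univ_of_forall fun y => by
    rw [Metric.mem_ball]
    linarith [hD y x, le_abs_self D]
  refine ⟨CP (r + 1) * ENNReal.ofReal r, by finiteness, fun w hw hwi => ?_⟩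
  have key := h w hw (r + 1) r x hr0 (by linarith) hwi.integrableOn
  rw [hball r le_rfl, hball (lam * r) (le_mul_of_one_le_left hr0.le hlam), Measure.restrict_univ,
    laverage_eq, laverage_eq, ← mul_div_assoc] at key
  rwa [ENNReal.div_le_iff hμ0 hμt, ENNReal.div_mul_cancel hμ0 hμt] at key

/-- The `(1,1)`-inequality for an odd power of `v - c` gives a `(p,p)`-inequality for `v`. -/
theorem GlobalPoincare.oscillation_le [BorelSpace X] [IsFiniteMeasure μ] {A : ℝ≥0∞}
    (hA : GlobalPoincare A μ) (hp : 1 < p) {v : X → ℝ} {K : ℝ≥0} (hv : LipschitzWith K v) {M : ℝ}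
    (hM : 0 ≤ M) (hvM : ∀ x, v x ∈ Icc 0 M) {G : X → ℝ≥0∞} (hGm : Measurable G)
    (hG : ∀ x, G x ≠ ∞) {k : ℝ≥0∞} (hk : k ≠ ∞)
    (h : ∀ x y, edist (v x) (v y) ≤ edist x y * (G x + k * edist x y)) :
    oscillation p μ v ≤
      2 ^ p * μ univ * (A * ENNReal.ofReal p) ^ p * ∫⁻ x, G x ^ p ∂μ := by
  have hvm : Measurable v := hv.continuous.measurable
  obtain ⟨c, hc, hc0⟩ := exists_integral_signedPow_eq_zero (μ := μ) hp hvm hM hvM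
  have hvc : ∀ x, |v x - c| ≤ M := fun x => abs_le.2
    ⟨by linarith [(hvM x).1, hc.2], by linarith [(hvM x).2, hc.1]⟩
  refine (MMS.oscillation_le hp.le hvm c).trans ?_
  rw [mul_assoc (2 ^ p * μ univ)]
  gcongr
  set w : X → ℝ := fun x => signedPow p (v x - c) with hw
  have hwL := lipschitzWith_signedPow_comp hp hv hvc
  have hwM : ∀ x, |w x| ≤ M ^ p := fun x => by
    rw [hw, abs_signedPow (by linarith)]
    exact Real.rpow_le_rpow (abs_nonneg _) (hvc x) (by linarith)
  have hwi : Integrable w μ := Integrable.of_bound hwL.continuous.measurable.aestronglyMeasurable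
    (M ^ p) (Eventually.of_forall hwM)
  have hedist : ∀ x, edist (w x) 0 = edist (v x) c ^ p := fun x => by
    rw [edist_dist, edist_dist, Real.dist_eq, Real.dist_eq, sub_zero, hw,
      abs_signedPow (by linarith), ENNReal.ofReal_rpow_of_nonneg (abs_nonneg _) (by linarith)]
  -- As `w` has mean zero, the left-hand side is exactly the integral of `|v - c|^p`.
  have h1 := hA w hwL.locallyLipschitz hwi
  rw [average_eq, hc0, smul_zero, lintegral_congr hedist] at h1
  have hem : Measurable fun x => edist (v x) c := hvm.edist measurable_const
  refine le_of_le_mul_rpow_mul_rpow hp ?_ ?_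
  · rw [← lintegral_congr hedist]
    simp only [edist_zero_right]
    exact hwi.2.ne
  have hpq : (p / (p - 1)).HolderConjugate p := (Real.HolderConjugate.conjExponent hp).symm
  have h2 := ENNReal.lintegral_mul_le_Lp_mul_Lq μ hpq
    (hem.pow_const (p - 1)).aemeasurable hGm.aemeasurable
  simp only [Pi.mul_apply, ← ENNReal.rpow_mul] at h2
  rw [mul_div_cancel₀ _ (by linarith : p - 1 ≠ 0)] at h2
  calc ∫⁻ x, edist (v x) c ^ p ∂μ ≤ A * ∫⁻ x, slope w x ∂μ := h1
    _ ≤ A * ∫⁻ x, ENNReal.ofReal p * (edist (v x) c ^ (p - 1) * G x) ∂μ := by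
        gcongr with x
        exact slope_signedPow_le hp hv.continuous c (hG x) hk (h x)
    _ = A * ENNReal.ofReal p * ∫⁻ x, edist (v x) c ^ (p - 1) * G x ∂μ := by
        rw [lintegral_const_mul' _ _ ENNReal.ofReal_ne_top, mul_assoc]
    _ ≤ _ := by gcongr

end MMS

/-! ### Curves in an ambient space with infinite cost outside `X`. -/

namespace MMS

variable {X : Type*} [MetricSpace X] {p : ℝ}

theorem isCompact_extend_le {E : Type*} [TopologicalSpace E] [T2Space E] {ι : X → E}
    (hι : Continuous ι) (hinj : ι.Injective) {H : X → ℝ≥0∞}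
    (hH : ∀ a : ℝ≥0∞, a ≠ ∞ → IsCompact {x | H x ≤ a}) {a : ℝ≥0∞} (ha : a ≠ ∞) :
    IsCompact {y | Function.extend ι H (fun _ => ∞) y ≤ a} := by
  have : {y | Function.extend ι H (fun _ => ∞) y ≤ a} = ι '' {x | H x ≤ a} := by
    ext y
    by_cases hy : ∃ x, ι x = y
    · obtain ⟨x, rfl⟩ := hy
      simp [hinj.extend_apply, hinj.eq_iff]
    · simp only [mem_ofPred_eq, Function.extend_apply' _ _ _ hy, top_le_iff, ha, false_iff]
      rintro ⟨x, -, rfl⟩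
      exact hy ⟨x, rfl⟩
  rw [this]
  exact (hH a ha).image hι

/-- Sublevel sets at heights below `m` are images of closed sets under a closed embedding; all other
sublevel sets are the whole space. -/
theorem lowerSemicontinuous_extend {E : Type*} [TopologicalSpace E] {ι : X → E}
    (hι : IsClosedEmbedding ι) {F : X → ℝ≥0∞} (hF : LowerSemicontinuous F) {m : ℝ≥0∞}
    (hFm : ∀ x, F x ≤ m) : LowerSemicontinuous (Function.extend ι F fun _ => m) := by
  refine lowerSemicontinuous_iff_isClosed_preimage.2 fun a => ?_
  rcases le_or_gt m a with ha | ha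
  · convert! isClosed_univ
    refine eq_univ_of_forall fun y => ?_
    by_cases hy : ∃ x, ι x = y
    · obtain ⟨x, rfl⟩ := hy
      simpa [hι.injective.extend_apply] using (hFm x).trans ha
    · simpa [Function.extend_apply' _ _ _ hy] using ha
  · convert! hι.isClosedMap _ (hF.isClosed_preimage a)
    ext y
    by_cases hy : ∃ x, ι x = y
    · obtain ⟨x, rfl⟩ := hy
      simp [hι.injective.extend_apply, hι.injective.eq_iff]
    · simp only [mem_preimage, Function.extend_apply' _ _ _ hy, mem_Iic, not_le.2 ha, false_iff]
      rintro ⟨x, -, rfl⟩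
      exact hy ⟨x, rfl⟩

theorem edist_toReal_le {a b q : ℝ≥0∞} (ha : a ≠ ∞) (hb : b ≠ ∞) (h1 : a ≤ b + q)
    (h2 : b ≤ a + q) : edist a.toReal b.toReal ≤ q := by
  rcases eq_or_ne q ∞ with rfl | hq
  · exact le_top
  rw [edist_dist, Real.dist_eq]
  refine ENNReal.ofReal_le_of_le_toReal (abs_le.2 ⟨?_, ?_⟩)
  · have := ENNReal.toReal_mono (by finiteness) h2
    rw [ENNReal.toReal_add ha hq] at this
    linarith
  · have := ENNReal.toReal_mono (by finiteness) h1
    rw [ENNReal.toReal_add hb hq] at this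
    linarith

variable [MeasurableSpace X] [BorelSpace X] {μ : Measure X}

/-- A function with upper gradient `H` is bounded by the cost of curves in an ambient space that
charges an infinite price outside of `X`. -/
theorem le_cost_of_upperGradient {E : Type*} [MetricSpace E] {ι : X → E} (hι : Isometry ι)
    (hcl : IsClosed (range ι)) {f : X → ℝ} {F H : X → ℝ≥0∞} (hHm : Measurable H)
    (hfF : ∀ x, ENNReal.ofReal (f x) ≤ F x)
    (hug : ∀ γ : RectCurve X, edist (f (γ.toFun γ.a)) (f (γ.toFun γ.b)) ≤ γ.lineIntegral H)
    {m : ℝ≥0∞} {x : X} {c : ℝ → E} {T : ℝ} (hc : LipschitzWith 1 c) (hc0 : c 0 = ι x) (hT : 0 ≤ T)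
    (hHEm : Measurable fun t => Function.extend ι H (fun _ => ∞) (c t)) :
    ENNReal.ofReal (f x) ≤ Function.extend ι F (fun _ => m) (c T) +
      ∫⁻ t in Icc 0 T, Function.extend ι H (fun _ => ∞) (c t) := by
  set HE := Function.extend ι H (fun _ => ∞) with hHE
  rcases eq_or_ne (∫⁻ t in Icc 0 T, HE (c t)) ∞ with htop | hfin
  · rw [htop, add_top]; exact le_top
  -- Finite cost puts `c t` in the range for almost every `t`; since the range is closed, continuity
  -- of the distance to it gives every `t`.
  have hrange : ∀ t ∈ Icc 0 T, c t ∈ range ι := by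
    rcases hT.eq_or_lt with rfl | hT0
    · intro t ht
      rw [Icc_self, mem_singleton_iff] at ht
      rw [ht, hc0]
      exact mem_range_self x
    have hcont : Continuous fun t => Metric.infDist (c t) (range ι) :=
      (Metric.continuous_infDist_pt _).comp hc.continuous
    have hae : (fun t => Metric.infDist (c t) (range ι)) =ᵐ[volume.restrict (Icc 0 T)]
        fun _ => 0 := by
      filter_upwards [ae_lt_top hHEm hfin] with t ht
      by_cases hy : ∃ x, ι x = c t
      · exact Metric.infDist_zero_of_mem hy
      · rw [hHE, Function.extend_apply' _ _ _ hy] at ht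
        exact absurd ht (lt_irrefl _)
    have heq := Measure.eqOn_Icc_of_ae_eq volume hT0.ne hae hcont.continuousOn continuousOn_const
    exact fun t ht => (hcl.mem_iff_infDist_zero ⟨ι x, mem_range_self x⟩).2 (heq ht)
  have : Nonempty X := ⟨x⟩
  set k : ℝ → X := fun t => Function.invFun ι (c t) with hk
  have hkc : ∀ t ∈ Icc 0 T, ι (k t) = c t := fun t ht => Function.invFun_eq (hrange t ht)
  have hkL : LipschitzOnWith 1 k (Icc 0 T) := fun s hs t ht => by
    rw [← hι.edist_eq, hkc s hs, hkc t ht]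
    exact hc s t
  have hk0 : k 0 = x := hι.injective (by rw [hkc 0 ⟨le_rfl, hT⟩, hc0])
  rw [← hkc T ⟨hT, le_rfl⟩, hι.injective.extend_apply]
  -- A `RectCurve` is non-constant, so equal end points are treated apart; there `f ≤ F` suffices.
  rcases eq_or_ne (k 0) (k T) with he | hne
  · rw [← he, hk0]
    exact (hfF x).trans le_self_add
  obtain ⟨γ, hγa, hγb, hγ⟩ := exists_rectCurve hT hkL hne hHm
  have h1 := (hug γ).trans hγ
  rw [hγa, hγb, hk0] at h1
  have h2 : ∫⁻ t in Icc 0 T, H (k t) = ∫⁻ t in Icc 0 T, HE (c t) :=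
    setLIntegral_congr_fun measurableSet_Icc fun t ht => by
      simp only [hHE, ← hkc t ht, hι.injective.extend_apply]
  rw [h2] at h1
  calc ENNReal.ofReal (f x) ≤ ENNReal.ofReal (f (k T) + dist (f x) (f (k T))) := by
        refine ENNReal.ofReal_le_ofReal ?_
        rw [Real.dist_eq]
        linarith [le_abs_self (f x - f (k T))]
    _ ≤ ENNReal.ofReal (f (k T)) + edist (f x) (f (k T)) := by
        rw [edist_dist]; exact ENNReal.ofReal_add_le
    _ ≤ F (k T) + ∫⁻ t in Icc 0 T, HE (c t) := add_le_add (hfF _) h1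

/-- A function with a coercive upper gradient `H` lies below a function that is squeezed under `F`
and whose oscillation is controlled by `H`. -/
theorem exists_oscillation_le [CompleteSpace X] [TopologicalSpace.SeparableSpace X]
    [IsFiniteMeasure μ] {A : ℝ≥0∞} (hA : GlobalPoincare A μ) {D : ℝ} (hD : ∀ x y : X, dist x y ≤ D)
    (hp : 1 < p) {f : X → ℝ} {M : ℝ} (hM : 0 ≤ M) {F H : X → ℝ≥0∞} (hF : LowerSemicontinuous F)
    (hfF : ∀ x, ENNReal.ofReal (f x) ≤ F x) (hFM : ∀ x, F x ≤ ENNReal.ofReal M)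
    (hHm : Measurable H) (hH : ∀ a : ℝ≥0∞, a ≠ ∞ → IsCompact {x | H x ≤ a}) {δ : ℝ≥0∞} (hδ : δ ≠ 0)
    (hδH : ∀ x, δ ≤ H x)
    (hug : ∀ γ : RectCurve X, edist (f (γ.toFun γ.a)) (f (γ.toFun γ.b)) ≤ γ.lineIntegral H) :
    ∃ U : X → ℝ, Measurable U ∧ (∀ x, f x ≤ U x) ∧ (∀ x, ENNReal.ofReal (U x) ≤ F x) ∧
      oscillation p μ U ≤
        2 ^ p * μ univ * (A * ENNReal.ofReal p) ^ p * ∫⁻ x, H x ^ p ∂μ := by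
  set ι := kuratowskiEmbedding X with hιdef
  have hι : Isometry ι := kuratowskiEmbedding.isometry X
  set HE := Function.extend ι H (fun _ => ∞) with hHE
  set FE := Function.extend ι F (fun _ => ENNReal.ofReal M) with hFE
  have hHEc : ∀ a : ℝ≥0∞, a ≠ ∞ → IsCompact {y | HE y ≤ a} := fun a ha =>
    isCompact_extend_le hι.continuous hι.injective hH ha
  have hHEl : LowerSemicontinuous HE := by
    refine lowerSemicontinuous_iff_isClosed_preimage.2 fun a => ?_
    rcases eq_or_ne a ∞ with rfl | ha
    · simp
    · exact (hHEc a ha).isClosed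
  have hδHE : ∀ y, δ ≤ HE y := fun y => by
    by_cases hy : ∃ x, ι x = y
    · obtain ⟨x, rfl⟩ := hy
      rw [hHE, hι.injective.extend_apply]
      exact hδH x
    · rw [hHE, Function.extend_apply' _ _ _ hy]
      exact le_top
  have hFEl : LowerSemicontinuous FE := lowerSemicontinuous_extend hι.isClosedEmbedding hF hFM
  have hHEx : ∀ x, HE (ι x) = H x := fun x => hι.injective.extend_apply _ _ x
  have hFEx : ∀ x, FE (ι x) = F x := fun x => hι.injective.extend_apply _ _ x
  set V : ℕ → X → ℝ≥0∞ := fun n x => valueFun FE (lipReg HE n) (ι x) with hV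
  have hVF : ∀ n x, V n x ≤ F x := fun n x => hFEx x ▸ valueFun_le_self (ι x)
  have hVfin : ∀ n x, V n x ≠ ∞ := fun n x =>
    ne_top_of_le_ne_top ENNReal.ofReal_ne_top ((hVF n x).trans (hFM x))
  have hVmono : ∀ x, Monotone fun n => V n x := fun x m n h =>
    valueFun_mono (fun y => lipReg_mono h y) _
  set S : X → ℝ≥0∞ := fun x => ⨆ n, V n x with hS
  have hSF : ∀ x, S x ≤ F x := fun x => iSup_le fun n => hVF n x
  have hSfin : ∀ x, S x ≠ ∞ := fun x =>
    ne_top_of_le_ne_top ENNReal.ofReal_ne_top ((hSF x).trans (hFM x))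
  have hfS : ∀ x, ENNReal.ofReal (f x) ≤ S x := by
    intro x
    obtain ⟨c, T, hc, hc0, hT, hle⟩ := exists_curve_le_iSup_valueFun (x := ι x) hFEl
      (by rw [hFEx]; exact ne_top_of_le_ne_top ENNReal.ofReal_ne_top (hFM x))
      (fun a => hHEc a (ENNReal.natCast_ne_top a)) hHEl hδ hδHE
    exact (le_cost_of_upperGradient hι hι.isClosedEmbedding.isClosed_range hHm hfF hug hc hc0 hT
      (hHEl.comp hc.continuous).measurable).trans hle
  set G : ℕ → X → ℝ≥0∞ := fun n x => lipReg HE n (ι x) with hG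
  set v : ℕ → X → ℝ := fun n x => (V n x).toReal with hv
  have hvG : ∀ n x y, edist (v n x) (v n y) ≤ edist x y * (G n x + 2 * n * edist x y) := by
    intro n x y
    have h2 : V n x ≤ V n y + edist x y * (G n x + 2 * n * edist x y) := by
      simpa only [hι.edist_eq] using valueFun_le_add_swap (F := FE) (lipReg_le_add n) (ι x) (ι y)
    have h1 : V n y ≤ V n x + edist x y * (G n x + 2 * n * edist x y) := by
      have := valueFun_le_add (F := FE) (lipReg_le_add (H := HE) n) (ι x) (ι y)
      rw [hι.edist_eq] at this
      refine this.trans ?_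
      gcongr
      exact le_mul_of_one_le_left bot_le one_le_two
    exact edist_toReal_le (hVfin n x) (hVfin n y) h2 h1
  -- The bound on the diameter turns the second-order term into a Lipschitz constant.
  have hvL : ∀ n : ℕ, LipschitzWith ((n : ℝ≥0) + 2 * n * Real.toNNReal D) (v n) := fun n x y => by
    refine (hvG n x y).trans ?_
    rw [mul_comm]
    push_cast
    gcongr
    · exact lipReg_le_natCast n _
    · rw [edist_dist]; exact ENNReal.ofReal_le_ofReal (hD x y)
  have hosc : ∀ n, oscillation p μ (v n) ≤
      2 ^ p * μ univ * (A * ENNReal.ofReal p) ^ p * ∫⁻ x, H x ^ p ∂μ := by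
    intro n
    refine (hA.oscillation_le hp (hvL n) hM (fun x => ⟨ENNReal.toReal_nonneg, ?_⟩)
      (G := G n) ((continuous_lipReg n).comp hι.continuous).measurable
      (fun x => ne_top_of_le_ne_top (ENNReal.natCast_ne_top n) (lipReg_le_natCast n _))
      (by finiteness) (hvG n)).trans ?_
    · exact ENNReal.toReal_le_of_le_ofReal hM ((hVF n x).trans (hFM x))
    · gcongr with x
      exact (lipReg_le_self n _).trans (hHEx x).le
  have hlim : ∀ x, Tendsto (fun n => v n x) atTop (𝓝 (S x).toReal) := fun x =>
    (ENNReal.tendsto_toReal (hSfin x)).comp (tendsto_atTop_iSup (hVmono x))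
  refine ⟨fun x => (S x).toReal, ?_, fun x => ?_, fun x => ?_, ?_⟩
  · exact measurable_of_tendsto_metrizable (fun n => (hvL n).continuous.measurable)
      (tendsto_pi_nhds.2 hlim)
  · exact (ENNReal.ofReal_le_iff_le_toReal (hSfin x)).1 (hfS x)
  · rw [ENNReal.ofReal_toReal (hSfin x)]; exact hSF x
  · refine (oscillation_le_liminf (fun n => (hvL n).continuous.measurable.aemeasurable)
      (Eventually.of_forall hlim)).trans ?_
    exact (liminf_le_liminf (Eventually.of_forall hosc)).trans (liminf_const _).le

end MMS

/-! ### From weak upper gradients to the inequality for Sobolev functions. -/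

namespace MMS

theorem IsWeakUpperGradient.comp_lipschitz {X : Type*} [MetricSpace X] [MeasurableSpace X]
    {p : ℝ} {μ : Measure X} {f : X → ℝ} {g : X → ℝ≥0∞}
    (hg : IsWeakUpperGradient p μ f g) {φ : ℝ → ℝ} (hφ : LipschitzWith 1 φ) :
    IsWeakUpperGradient p μ (fun x => φ (f x)) g := by
  refine ⟨hg.1, modulus_null_mono (fun γ hγ => ?_) hg.2⟩
  refine fun hle : edist (f (γ.toFun γ.a)) (f (γ.toFun γ.b)) ≤ _ => hγ ?_
  exact (by simpa using hφ _ _ : edist (φ (f (γ.toFun γ.a))) (φ (f (γ.toFun γ.b))) ≤ _).trans hle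

theorem spectralGap_pos_of_poincare {X : Type*} [MetricSpace X] [MeasurableSpace X] {μ : Measure X}
    {C : ℝ≥0} (h : ∀ f : X → ℝ, MemSobolev 2 μ f →
    ∫⁻ x, edist (f x) (⨍ y, f y ∂μ) ^ (2 : ℝ) ∂μ ≤
      C * ∫⁻ x, minimalUpperGradient 2 μ f x ^ (2 : ℝ) ∂μ) : 0 < spectralGap μ := by
  have hC : (0 : ℝ≥0∞) < (C : ℝ≥0∞)⁻¹ := by simp
  refine hC.trans_le (le_iInf₂ fun u hu => ?_)
  obtain ⟨hus, hu0, hu1⟩ := hu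
  have h1 := h u hus
  rw [average_eq, hu0, smul_zero] at h1
  have h2 : ∫⁻ x, edist (u x) 0 ^ (2 : ℝ) ∂μ = 1 := by
    have hi : Integrable (fun x => u x ^ 2) μ := by
      -- A non-integrable square would have integral `0` by convention, contradicting the
      -- normalization.
      by_contra hni
      rw [integral_undef hni] at hu1
      exact zero_ne_one hu1
    rw [← ENNReal.ofReal_one, ← hu1, ofReal_integral_eq_lintegral_ofReal hi
      (Eventually.of_forall fun x => sq_nonneg _)]
    refine lintegral_congr fun x => ?_
    rw [edist_zero_right, Real.enorm_eq_ofReal_abs, ENNReal.rpow_two,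
      ← ENNReal.ofReal_pow (abs_nonneg _), sq_abs]
  rw [h2] at h1
  simp only [ENNReal.rpow_two] at h1
  rw [ENNReal.inv_le_iff_le_mul]
  · exact h1
  · rintro - hC
    simp [hC] at h1
  · exact fun hC => absurd hC ENNReal.coe_ne_top

variable {X : Type*} [MetricSpace X] [MeasurableSpace X] [BorelSpace X] {p : ℝ} {μ : Measure X}

/-- A bounded function with a `p`-weak upper gradient `g` has an upper gradient (along all curves)
with compact sublevel sets and nearly the same norm. -/
theorem IsWeakUpperGradient.exists_coercive [CompleteSpace X] [TopologicalSpace.SeparableSpace X]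
    [IsFiniteMeasure μ] (hp : 1 < p) {f : X → ℝ} {M : ℝ} (hfM : ∀ x, f x ∈ Icc 0 M) {g : X → ℝ≥0∞}
    (hg : IsWeakUpperGradient p μ f g) {ε : ℝ≥0∞} (hε : ε ≠ 0) :
    ∃ H : X → ℝ≥0∞, Measurable H ∧ (∀ a : ℝ≥0∞, a ≠ ∞ → IsCompact {x | H x ≤ a}) ∧
      (∃ δ : ℝ≥0∞, δ ≠ 0 ∧ ∀ x, δ ≤ H x) ∧
      (∀ γ : RectCurve X, edist (f (γ.toFun γ.a)) (f (γ.toFun γ.b)) ≤ γ.lineIntegral H) ∧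
      ∫⁻ x, H x ^ p ∂μ ≤ 2 ^ (p - 1) * ∫⁻ x, g x ^ p ∂μ +
        (2 ^ (p - 1) * ENNReal.ofReal M ^ p + 2 + μ univ) * ε := by
  have hp0 : 0 < p := by linarith
  have hm : modulus p μ {γ | ¬ edist (f (γ.toFun γ.a)) (f (γ.toFun γ.b)) ≤ γ.lineIntegral g} < ε := by
    rw [hg.2]; exact pos_iff_ne_zero.2 hε
  -- On exceptional curves `f` varies by at most `M`, while `ρ` has integral at least `1`; hence `g
  -- + M ρ` is an upper gradient along all curves.
  obtain ⟨ρ, ⟨hρm, hρ⟩, hρε⟩ : ∃ ρ : X → ℝ≥0∞, (Measurable ρ ∧ ∀ γ ∈ {γ : RectCurve X |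
      ¬ edist (f (γ.toFun γ.a)) (f (γ.toFun γ.b)) ≤ γ.lineIntegral g}, 1 ≤ γ.lineIntegral ρ) ∧
      ∫⁻ x, ρ x ^ p ∂μ < ε := by
    simpa only [modulus, iInf_lt_iff, exists_prop] using hm
  set m := ENNReal.ofReal M with hmdef
  have hgp : Measurable fun x => g x ^ p := hg.1.pow_const p
  have hρp : Measurable fun x => (m * ρ x) ^ p := (hρm.const_mul m).pow_const p
  obtain ⟨Φ, hΦ, hΦl, hΦi⟩ := exists_le_lowerSemicontinuous_lintegral_ge (μ := μ)
    (fun x => 2 ^ (p - 1) * (g x ^ p + (m * ρ x) ^ p)) ((hgp.add hρp).const_mul _) hε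
  obtain ⟨η, hη, hηsum⟩ := ENNReal.exists_pos_sum_of_countable' hε ℕ
  have htight := fun i => isTightMeasureSet_iff_exists_isCompact_measure_compl_le.1
    (isTightMeasureSet_singleton (μ := μ)) (η i) (hη i)
  choose K hK hKη using htight
  -- Tightness of `μ` makes `W` of small integral, and `W ≥ N` off the compact set `⋃ i < N, K i`;
  -- this is the source of coercivity. The summand `ε` in `Ψ` supplies the positive lower bound.
  set W : X → ℝ≥0∞ := fun x => ∑' i, (K i)ᶜ.indicator (fun _ => 1) x with hW
  have hWl : LowerSemicontinuous W := lowerSemicontinuous_tsum fun i =>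
    (hK i).isClosed.isOpen_compl.lowerSemicontinuous_indicator zero_le_one
  have hWi : ∫⁻ x, W x ∂μ ≤ ε := by
    rw [hW, lintegral_tsum fun i =>
      (measurable_const.indicator (hK i).measurableSet.compl).aemeasurable]
    refine le_trans (ENNReal.tsum_le_tsum fun i => ?_) hηsum.le
    rw [lintegral_indicator_const (hK i).measurableSet.compl, one_mul]
    exact hKη i μ rfl
  set Ψ : X → ℝ≥0∞ := fun x => Φ x + ε + W x with hΨ
  have hΨl : LowerSemicontinuous Ψ := (hΦl.add lowerSemicontinuous_const).add hWl
  have hHle : ∀ x a, Ψ x ^ (1 / p) ≤ a ↔ Ψ x ≤ a ^ p := fun x a => by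
    rw [one_div, ENNReal.rpow_inv_le_iff hp0]
  have hgH : ∀ x, g x + m * ρ x ≤ Ψ x ^ (1 / p) := fun x => by
    rw [one_div, ENNReal.le_rpow_inv_iff hp0]
    refine (ENNReal.rpow_add_le_mul_rpow_add_rpow _ _ hp.le).trans ((hΦ x).trans ?_)
    rw [hΨ]
    exact le_self_add.trans le_self_add
  refine ⟨fun x => Ψ x ^ (1 / p), hΨl.measurable.pow_const _, fun a ha => ?_,
    ⟨ε ^ (1 / p), ?_, fun x => ?_⟩, fun γ => ?_, ?_⟩
  · obtain ⟨N, hN⟩ := ENNReal.exists_nat_gt (ENNReal.rpow_ne_top_of_nonneg hp0.le ha)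
    simp only [hHle]
    refine ((Finset.range N).isCompact_biUnion fun i _ => hK i).of_isClosed_subset
      (hΨl.isClosed_preimage _) fun x hx => ?_
    by_contra hnot
    simp only [Finset.mem_range, mem_iUnion, exists_prop, not_exists, not_and] at hnot
    have h1 : (N : ℝ≥0∞) ≤ W x := by
      refine le_trans ?_ (ENNReal.sum_le_tsum (Finset.range N))
      rw [Finset.sum_congr rfl fun i hi => indicator_of_mem
        (show x ∈ (K i)ᶜ from hnot i (Finset.mem_range.1 hi)) _]
      simp
    exact absurd (hN.trans_le (h1.trans le_add_self)) (not_lt.2 hx)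
  · simp [ENNReal.rpow_eq_zero_iff, hε, hp0.le]
  · exact ENNReal.rpow_le_rpow (le_add_self.trans le_self_add) (by positivity)
  · by_cases hγ : edist (f (γ.toFun γ.a)) (f (γ.toFun γ.b)) ≤ γ.lineIntegral g
    · exact hγ.trans (lintegral_mono fun t => le_self_add.trans (hgH _))
    · have h1 : edist (f (γ.toFun γ.a)) (f (γ.toFun γ.b)) ≤ m := by
        rw [edist_dist, Real.dist_eq]
        refine ENNReal.ofReal_le_ofReal (abs_le.2 ⟨?_, ?_⟩) <;>
        linarith [(hfM (γ.toFun γ.a)).1, (hfM (γ.toFun γ.a)).2, (hfM (γ.toFun γ.b)).1,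
          (hfM (γ.toFun γ.b)).2]
      calc edist (f (γ.toFun γ.a)) (f (γ.toFun γ.b)) ≤ m * γ.lineIntegral ρ :=
            h1.trans (le_mul_of_one_le_right bot_le (hρ γ hγ))
        _ = γ.lineIntegral fun x => m * ρ x :=
            (lintegral_const_mul' _ _ ENNReal.ofReal_ne_top).symm
        _ ≤ _ := lintegral_mono fun t => le_add_self.trans (hgH _)
  · have e : ∀ x, (Ψ x ^ (1 / p)) ^ p = Ψ x := fun x => by
      rw [← ENNReal.rpow_mul, one_div_mul_cancel hp0.ne', ENNReal.rpow_one]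
    have hm2 : ∫⁻ x, (m * ρ x) ^ p ∂μ = m ^ p * ∫⁻ x, ρ x ^ p ∂μ := by
      simp only [ENNReal.mul_rpow_of_nonneg _ _ hp0.le]
      rw [lintegral_const_mul _ (hρm.pow_const p)]
    calc ∫⁻ x, (Ψ x ^ (1 / p)) ^ p ∂μ = ∫⁻ x, Φ x ∂μ + ε * μ univ + ∫⁻ x, W x ∂μ := by
          simp only [e]
          rw [hΨ, lintegral_add_right _ hWl.measurable, lintegral_add_right _ measurable_const,
            lintegral_const]
      _ ≤ (2 ^ (p - 1) * (∫⁻ x, g x ^ p ∂μ + m ^ p * ε) + ε) + ε * μ univ + ε := by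
          refine add_le_add (add_le_add (hΦi.trans ?_) le_rfl) hWi
          rw [lintegral_const_mul _ (by exact hgp.add hρp), lintegral_add_left hgp, hm2]
          gcongr
      _ = _ := by ring

/-- The Poincaré inequality for bounded functions. -/
theorem IsWeakUpperGradient.oscillation_le_of_bounded [CompleteSpace X]
    [TopologicalSpace.SeparableSpace X] [IsFiniteMeasure μ] {A : ℝ≥0∞} (hAt : A ≠ ∞)
    (hA : GlobalPoincare A μ) {D : ℝ} (hD : ∀ x y : X, dist x y ≤ D) (hp : 1 < p) {f : X → ℝ}
    {M : ℝ} (hM : 0 ≤ M) (hfM : ∀ x, f x ∈ Icc 0 M) (hf : AEMeasurable f μ) {g : X → ℝ≥0∞}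
    (hg : IsWeakUpperGradient p μ f g) :
    oscillation p μ f ≤ 2 ^ p * μ univ * (A * ENNReal.ofReal p) ^ p *
      (2 ^ (p - 1) * ∫⁻ x, g x ^ p ∂μ) := by
  have hp0 : 0 ≤ p := by linarith
  set B := 2 ^ p * μ univ * (A * ENNReal.ofReal p) ^ p with hB
  have hBt : B ≠ ∞ := by finiteness
  set C := 2 ^ (p - 1) * ENNReal.ofReal M ^ p + 2 + μ univ with hC
  have hCt : C ≠ ∞ := by finiteness
  -- Summable errors make the sum of the `U k - f` integrable, so that `U k` tends to `f` a.e.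
  -- without passing to a subsequence.
  obtain ⟨ε, hε, hεsum⟩ := ENNReal.exists_pos_sum_of_countable' (one_ne_zero (α := ℝ≥0∞)) ℕ
  have hstep : ∀ k, ∃ U : X → ℝ, Measurable U ∧ (∀ x, f x ≤ U x) ∧
      ∫⁻ x, ENNReal.ofReal (U x - f x) ∂μ ≤ ε k ∧
      oscillation p μ U ≤ B * (2 ^ (p - 1) * ∫⁻ x, g x ^ p ∂μ + C * ε k) := by
    intro k
    obtain ⟨H, hHm, hHc, ⟨δ, hδ, hδH⟩, hug, hHi⟩ := hg.exists_coercive hp hfM (hε k).ne'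
    obtain ⟨F, hF, hFl, hFi⟩ := exists_lt_lowerSemicontinuous_lintegral_ge_of_aemeasurable (μ := μ)
      (fun x => (f x).toNNReal) hf.real_toNNReal (hε k).ne'
    obtain ⟨U, hUm, hfU, hUF, hUo⟩ := exists_oscillation_le hA hD hp hM
      (F := fun x => Min.min (F x) (ENNReal.ofReal M)) (hFl.inf lowerSemicontinuous_const)
      (fun x => le_min (hF x).le (ENNReal.ofReal_le_ofReal (hfM x).2)) (fun x => min_le_right _ _)
      hHm hHc hδ hδH hug
    refine ⟨U, hUm, hfU, ?_, hUo.trans (by gcongr)⟩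
    have hfin : ∫⁻ x, ENNReal.ofReal (f x) ∂μ ≠ ∞ := by
      refine ne_top_of_le_ne_top (b := ∫⁻ _, ENNReal.ofReal M ∂μ) ?_
        (lintegral_mono fun x => ENNReal.ofReal_le_ofReal (hfM x).2)
      rw [lintegral_const]; finiteness
    refine (ENNReal.add_le_add_iff_left hfin).1 (le_trans ?_ hFi)
    rw [← lintegral_add_left' hf.ennreal_ofReal]
    refine lintegral_mono fun x => ?_
    rw [← ENNReal.ofReal_add (hfM x).1 (sub_nonneg.2 (hfU x)), add_sub_cancel]
    exact (hUF x).trans (min_le_left _ _)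
  choose U hUm hfU hUi hUo using hstep
  have hεlim : Tendsto ε atTop (𝓝 0) :=
    ENNReal.tendsto_atTop_zero_of_tsum_ne_top (hεsum.trans ENNReal.one_lt_top).ne
  have hlim : ∀ᵐ x ∂μ, Tendsto (fun k => U k x) atTop (𝓝 (f x)) := by
    have hmeas : ∀ k, AEMeasurable (fun x => ENNReal.ofReal (U k x - f x)) μ := fun k =>
      ((hUm k).aemeasurable.sub hf).ennreal_ofReal
    have hsum : ∫⁻ x, ∑' k, ENNReal.ofReal (U k x - f x) ∂μ ≠ ∞ := by
      rw [lintegral_tsum hmeas]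
      exact ((ENNReal.tsum_le_tsum hUi).trans_lt (hεsum.trans ENNReal.one_lt_top)).ne
    filter_upwards [ae_lt_top' (AEMeasurable.tsum hmeas) hsum] with x hx
    have h1 := (ENNReal.tendsto_toReal ENNReal.zero_ne_top).comp
      (ENNReal.tendsto_atTop_zero_of_tsum_ne_top hx.ne)
    have h2 : ∀ k, (ENNReal.ofReal (U k x - f x)).toReal + f x = U k x := fun k => by
      rw [ENNReal.toReal_ofReal (sub_nonneg.2 (hfU k x)), sub_add_cancel]
    have h3 := h1.add_const (f x)
    simp only [Function.comp_def, h2, ENNReal.toReal_zero, zero_add] at h3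
    exact h3
  have hBlim : Tendsto (fun k => B * (2 ^ (p - 1) * ∫⁻ x, g x ^ p ∂μ + C * ε k)) atTop
      (𝓝 (B * (2 ^ (p - 1) * ∫⁻ x, g x ^ p ∂μ))) := by
    refine ENNReal.Tendsto.const_mul ?_ (Or.inr hBt)
    simpa using tendsto_const_nhds.add (ENNReal.Tendsto.const_mul hεlim (Or.inr hCt))
  calc oscillation p μ f ≤ liminf (fun k => oscillation p μ (U k)) atTop :=
        oscillation_le_liminf (fun k => (hUm k).aemeasurable) hlim
    _ ≤ liminf (fun k => B * (2 ^ (p - 1) * ∫⁻ x, g x ^ p ∂μ + C * ε k)) atTop :=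
        liminf_le_liminf (Eventually.of_forall hUo)
    _ = _ := hBlim.liminf_eq

/-- Truncation at heights `±n` keeps the upper gradient, and adding `n` moves the values into `[0,
2n]` without changing the oscillation. -/
theorem IsSobolevUpperGradient.oscillation_le [CompleteSpace X]
    [TopologicalSpace.SeparableSpace X] [IsFiniteMeasure μ] {A : ℝ≥0∞} (hAt : A ≠ ∞)
    (hA : GlobalPoincare A μ) {D : ℝ} (hD : ∀ x y : X, dist x y ≤ D) (hp : 1 < p) {f : X → ℝ}
    (hf : AEMeasurable f μ) {g : X → ℝ≥0∞} (hg : IsSobolevUpperGradient p μ f g) :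
    oscillation p μ f ≤ 2 ^ p * μ univ * (A * ENNReal.ofReal p) ^ p *
      (2 ^ (p - 1) * ∫⁻ x, g x ^ p ∂μ) := by
  obtain ⟨-, f', hff', hg'⟩ := hg
  have hf' : AEMeasurable f' μ := hf.congr hff'.symm
  set φ : ℕ → ℝ → ℝ := fun n t => max (-n) (Min.min t n) with hφ
  have hφL : ∀ n, LipschitzWith 1 (φ n) := fun n =>
    (LipschitzWith.id.min_const (n : ℝ)).const_max (-n)
  have hosc : ∀ n, oscillation p μ (fun x => φ n (f' x)) ≤ 2 ^ p * μ univ *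
      (A * ENNReal.ofReal p) ^ p * (2 ^ (p - 1) * ∫⁻ x, g x ^ p ∂μ) := by
    intro n
    have hsh : LipschitzWith 1 fun t => φ n t + n := fun s t => by
      simpa only [edist_add_right] using hφL n s t
    have h1 := (hg'.comp_lipschitz hsh).oscillation_le_of_bounded hAt hA hD hp
      (M := 2 * n) (by positivity) (fun x => ⟨?_, ?_⟩)
      (by exact hsh.continuous.measurable.comp_aemeasurable hf')
    · simpa only [oscillation, edist_add_right] using h1
    · simp only [hφ]
      linarith [le_max_left (-(n : ℝ)) (Min.min (f' x) n)]
    · have h2 : max (-(n : ℝ)) (Min.min (f' x) n) ≤ n :=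
        max_le (by linarith [n.cast_nonneg (α := ℝ)]) (min_le_right _ _)
      simp only [hφ]
      linarith
  refine (oscillation_le_liminf (F := fun n x => φ n (f' x)) (fun n =>
    (hφL n).continuous.measurable.comp_aemeasurable hf') ?_).trans
    ((liminf_le_liminf (Eventually.of_forall hosc)).trans (liminf_const _).le)
  filter_upwards [hff'] with x hx
  refine tendsto_const_nhds.congr' ?_
  obtain ⟨N, hN⟩ := exists_nat_ge |f x|
  filter_upwards [eventually_ge_atTop N] with n hn
  have h1 : |f x| ≤ n := hN.trans (by exact_mod_cast hn)
  rw [hφ, hx]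
  beta_reduce
  rw [min_eq_left (abs_le.1 h1).2, max_eq_right (abs_le.1 h1).1]

theorem WeakLocalPoincare.exists_poincare [CompleteSpace X] [TopologicalSpace.SeparableSpace X]
    [IsFiniteMeasure μ] {D : ℝ} (hD : ∀ x y : X, dist x y ≤ D) (hP : WeakLocalPoincare μ)
    (hp : 1 < p) :
    ∃ C : ℝ≥0, 0 < C ∧ ∀ f : X → ℝ, MemSobolev p μ f →
      ∫⁻ x, edist (f x) (⨍ y, f y ∂μ) ^ p ∂μ ≤
        C * ∫⁻ x, minimalUpperGradient p μ f x ^ p ∂μ := by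
  rcases eq_or_ne μ 0 with rfl | hμ
  · exact ⟨1, one_pos, fun f _ => by simp⟩
  obtain ⟨A, hAt, hA⟩ := hP.exists_globalPoincare hμ hD
  have hp0 : 0 < p := by linarith
  have hμ0 : μ univ ≠ 0 := by simpa using hμ
  set B := (μ univ)⁻¹ * (2 ^ p * μ univ * (A * ENNReal.ofReal p) ^ p * 2 ^ (p - 1)) with hB
  have hBt : B ≠ ∞ := by finiteness
  -- The summand `1` makes the constant positive without examining whether `B` vanishes.
  refine ⟨B.toNNReal + 1, by positivity, fun f hf => ?_⟩
  have hfi : Integrable f μ := hf.1.integrable (by simpa using hp.le)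
  have hmin := isMinimalUpperGradient_minimalUpperGradient hp0 hf
  calc ∫⁻ x, edist (f x) (⨍ y, f y ∂μ) ^ p ∂μ ≤ (μ univ)⁻¹ * oscillation p μ f :=
        lintegral_edist_average_le hp hfi hμ
    _ ≤ B * ∫⁻ x, minimalUpperGradient p μ f x ^ p ∂μ := by
        rw [hB, mul_assoc, mul_assoc (2 ^ p * μ univ * _)]
        gcongr
        exact hmin.1.oscillation_le hAt hA hD hp hfi.aemeasurable
    _ ≤ _ := by
        gcongr
        rw [ENNReal.coe_add, ENNReal.coe_toNNReal hBt]
        exact le_self_add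

end MMS

theorem theorem2p3 {X : Type*} [MetricSpace X] [CompleteSpace X]
    [TopologicalSpace.SeparableSpace X] [MeasurableSpace X] [BorelSpace X]
    (μ : Measure X) [μ.IsOpenPosMeasure]
    (hμ : ∀ s : Set X, Bornology.IsBounded s → μ s < ∞)
    (D : ℝ) (hD : ∀ x y : X, dist x y ≤ D) (hP : MMS.WeakLocalPoincare μ) :
    (∀ p : ℝ, 1 < p → ∃ C : ℝ≥0, 0 < C ∧ ∀ f : X → ℝ, MMS.MemSobolev p μ f →
      ∫⁻ x, edist (f x) (⨍ y, f y ∂μ) ^ p ∂μ ≤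
        C * ∫⁻ x, MMS.minimalUpperGradient p μ f x ^ p ∂μ) ∧
    0 < MMS.spectralGap μ := by
  have : IsFiniteMeasure μ :=
    ⟨hμ univ (Metric.isBounded_iff.2 ⟨D, fun x _ y _ => hD x y⟩)⟩
  refine ⟨fun p hp => hP.exists_poincare hD hp, ?_⟩
  obtain ⟨C, -, hC⟩ := hP.exists_poincare hD one_lt_two
  exact MMS.spectralGap_pos_of_poincare hC
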